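/- **Theorem 3.3 (simplicity of the vacuum module).** Let $\mathfrak g$ be the N=1 BMS superalgebra, i.e. the complex Lie superalgebra with basis $L_n, M_n$ ($n\in\mathbb Z$), $\mathbf c_1,\mathbf c_2$ (even) and $Q_r$ ($r\in\mathbb Z+\frac12$) (odd), and brackets $$[L_m,L_n]=(m-n)L_{m+n}+\tfrac1{12}\delta_{m+n,0}(m^3-m)\mathbf c_1,\qquad [L_m,M_n]=(m-n)M_{m+n}+\tfrac1{12}\delta_{m+n,0}(m^3-m)\mathbf c_2,$$ $$[Q_r,Q_s]=2M_{r+s}+\tfrac13\delta_{r+s,0}\left(r^2-\tfrac14\right)\mathbf c_2,\qquad [L_m,Q_r]=\left(\tfrac m2-r\right)Q_{m+r},$$ $$[M_m,M_n]=[M_n,Q_r]=0,\qquad [\mathbf c_1,\mathfrak g]=[\mathbf c_2,\mathfrak g]=0.$$ Let $\mathfrak g_0=\operatorname{span}(L_0,M_0,\mathbf c_1,\mathbf c_2)$ and $\mathfrak g_+=\operatorname{span}(L_n,M_n,Q_r : n\ge 1,\ r\ge\frac12)$. For $h_1,h_2,c_1,c_2\in\mathbb C$ let $M_{\mathfrak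 g}(h_1,h_2,c_1,c_2)=U(\mathfrak g)\otimes_{U(\mathfrak g_0\oplus\mathfrak g_+)}\mathbb C$ be the Verma module, where $L_0,M_0,\mathbf c_1,\mathbf c_2$ act on $\mathbb C$ by $h_1,h_2,c_1,c_2$ respectively and $\mathfrak g_+$ acts by $0$, and put $\mathbf 1=1\otimes 1$. Let $$V_{\mathfrak g}(c_1,c_2)=M_{\mathfrak g}(0,0,c_1,c_2)/J,$$ where $J$ is the submodule of $M_{\mathfrak g}(0,0,c_1,c_2)$ generated by $L_{-1}\mathbf 1$. Then for all $c_1,c_2\in\mathbb C$, the $\mathfrak g$-module $V_{\mathfrak g}(c_1,c_2)$ is simple if and only if $c_2\neq 0$. -/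

import Mathlib

/-- A Lie superalgebra over `ℂ`: a `ℤ/2`-graded space `g = g₀ ⊕ g₁` with an even bilinear bracket
which is super skew-symmetric and satisfies the super Jacobi identity. -/
class LieSuperalgebra (g : Type*) [AddCommGroup g] [Module ℂ g] where
  /-- the homogeneous part of parity `i` -/
  part : ZMod 2 → Submodule ℂ g
  /-- the bracket -/
  sbr : g →ₗ[ℂ] g →ₗ[ℂ] g
  isCompl : IsCompl (part 0) (part 1)
  sbr_mem : ∀ (i j : ZMod 2) (x y : g), x ∈ part i → y ∈ part j → sbr x y ∈ part (i + j)
  sbr_skew : ∀ (i j : ZMod 2) (x y : g), x ∈ part i → y ∈ part j →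
    sbr x y = -((-1 : ℂ) ^ (i.val * j.val) • sbr y x)
  sbr_jacobi : ∀ (i j k : ZMod 2) (x y z : g), x ∈ part i → y ∈ part j → z ∈ part k →
    sbr x (sbr y z) = sbr (sbr x y) z + (-1 : ℂ) ^ (i.val * j.val) • sbr y (sbr x z)

namespace LieSuperalgebra

/-- The relations `x y - (-1)^{|x||y|} y x = [x, y]` (`x`, `y` homogeneous) in the tensor algebra. -/
inductive EnvRel (g : Type*) [AddCommGroup g] [Module ℂ g] [LieSuperalgebra g] :
    TensorAlgebra ℂ g → TensorAlgebra ℂ g → Prop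
  | comm (i j : ZMod 2) (x y : g) (hx : x ∈ part i) (hy : y ∈ part j) :
      EnvRel g
        (TensorAlgebra.ι ℂ x * TensorAlgebra.ι ℂ y
          - (-1 : ℂ) ^ (i.val * j.val) • (TensorAlgebra.ι ℂ y * TensorAlgebra.ι ℂ x))
        (TensorAlgebra.ι ℂ (sbr x y))

/-- The universal enveloping algebra `U(g)` of a Lie superalgebra. -/
abbrev Env (g : Type*) [AddCommGroup g] [Module ℂ g] [LieSuperalgebra g] : Type _ :=
  RingQuot (EnvRel g)

/-- The canonical map `g → U(g)`. -/
noncomputable def toEnv (g : Type*) [AddCommGroup g] [Module ℂ g] [LieSuperalgebra g] :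
    g →ₗ[ℂ] Env g :=
  (RingQuot.mkAlgHom ℂ (EnvRel g)).toLinearMap ∘ₗ TensorAlgebra.ι ℂ

end LieSuperalgebra

namespace BMS

/-- Labels of the standard basis: `L n`, `M n` for `n ∈ ℤ`, the two central elements, and
`Q k`, which stands for the odd element `Q_r` with `r = k + 1/2`, `k ∈ ℤ`. -/
inductive Gen : Type
  | L (n : ℤ)
  | M (n : ℤ)
  | Q (k : ℤ)
  | c₁
  | c₂

/-- The underlying space of the N=1 BMS superalgebra. -/
abbrev Alg : Type := Gen →₀ ℂ

/-- The basis vector with a given label. -/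
noncomputable def e (a : Gen) : Alg := Finsupp.single a 1

/-- Parity of a basis vector. -/
def parity : Gen → ZMod 2
  | .Q _ => 1
  | _ => 0

/-- The brackets of basis vectors (recall that `Q k` is `Q_{k+1/2}`). -/
noncomputable def brGen : Gen → Gen → Alg
  | .L m, .L n => ((m : ℂ) - n) • e (.L (m + n))
      + if m + n = 0 then (((m : ℂ) ^ 3 - m) / 12) • e .c₁ else 0
  | .L m, .M n => ((m : ℂ) - n) • e (.M (m + n))
      + if m + n = 0 then (((m : ℂ) ^ 3 - m) / 12) • e .c₂ else 0
  | .M n, .L m => -(((m : ℂ) - n) • e (.M (m + n))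
      + if m + n = 0 then (((m : ℂ) ^ 3 - m) / 12) • e .c₂ else 0)
  | .Q k, .Q l => (2 : ℂ) • e (.M (k + l + 1))
      + if k + l + 1 = 0 then ((1 / 3 : ℂ) * (((k : ℂ) + 1 / 2) ^ 2 - 1 / 4)) • e .c₂ else 0
  | .L m, .Q k => ((m : ℂ) / 2 - ((k : ℂ) + 1 / 2)) • e (.Q (m + k))
  | .Q k, .L m => -(((m : ℂ) / 2 - ((k : ℂ) + 1 / 2)) • e (.Q (m + k)))
  | _, _ => 0

/-- The bracket, extended bilinearly from the basis. -/
noncomputable def br : Alg →ₗ[ℂ] Alg →ₗ[ℂ] Alg :=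
  Finsupp.linearCombination ℂ fun a => Finsupp.linearCombination ℂ (brGen a)

/-- The part of parity `i`: the span of the basis vectors of parity `i`. -/
noncomputable def part (i : ZMod 2) : Submodule ℂ Alg :=
  Submodule.span ℂ (e '' {a | parity a = i})

theorem br_e (a b : Gen) : br (e a) (e b) = brGen a b := by
  simp [br, e]

theorem e_mem (a : Gen) : e a ∈ part (parity a) :=
  Submodule.subset_span ⟨a, rfl, rfl⟩

theorem brGen_mem (a b : Gen) : brGen a b ∈ part (parity a + parity b) := by
  have hL (n : ℤ) : e (.L n) ∈ part 0 := e_mem (.L n)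
  have hM (n : ℤ) : e (.M n) ∈ part 0 := e_mem (.M n)
  have hQ (n : ℤ) : e (.Q n) ∈ part 1 := e_mem (.Q n)
  have h1 : e .c₁ ∈ part 0 := e_mem .c₁
  have h2 : e .c₂ ∈ part 0 := e_mem .c₂
  have h3 : (1 : ZMod 2) + 1 = 0 := by decide
  rcases a with m | m | m | _ | _ <;> rcases b with n | n | n | _ | _ <;>
    simp only [brGen, parity, add_zero, zero_add, h3] <;>
    (try split_ifs) <;>
    repeat' first
      | exact Submodule.zero_mem _
      | with_reducible exact hL _
      | with_reducible exact hM _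
      | with_reducible exact hQ _
      | with_reducible exact h1
      | with_reducible exact h2
      | with_reducible refine Submodule.add_mem _ ?_ ?_
      | with_reducible refine Submodule.neg_mem _ ?_
      | with_reducible refine Submodule.smul_mem _ _ ?_

theorem brGen_skew (a b : Gen) :
    brGen a b = -((-1 : ℂ) ^ ((parity a).val * (parity b).val) • brGen b a) := by
  have hv : (1 : ZMod 2).val = 1 := rfl
  rcases a with m | m | m | _ | _ <;> rcases b with n | n | n | _ | _ <;>
    simp only [brGen, parity, hv, ZMod.val_zero, mul_zero, mul_one, pow_zero, pow_one,
      one_smul, neg_neg, neg_zero, smul_zero]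
  · rw [add_comm n m]
    by_cases h : m + n = 0
    · obtain rfl : n = -m := by omega
      simp only [h, if_true]; push_cast; module
    · simp only [h, if_false]; module
  · rw [add_comm n m, neg_smul, one_smul, neg_neg, show m + n + 1 = n + m + 1 by ring]
    by_cases h : n + m + 1 = 0
    · obtain rfl : n = -m - 1 := by omega
      simp only [h, if_true]; push_cast; module
    · simp only [h, if_false]

set_option maxHeartbeats 1000000 in
theorem brGen_jacobi (a b c : Gen) :
    br (e a) (brGen b c) = br (brGen a b) (e c)
      + (-1 : ℂ) ^ ((parity a).val * (parity b).val) • br (e b) (brGen a c) := by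
  have hv : (1 : ZMod 2).val = 1 := rfl
  have ite_br (p : Prop) [Decidable p] (x y : Alg) :
      br (if p then x else 0) y = if p then br x y else 0 := by split_ifs <;> simp
  have br_ite (p : Prop) [Decidable p] (x y : Alg) :
      br y (if p then x else 0) = if p then br y x else 0 := by split_ifs <;> simp
  rcases a with m | m | m | _ | _ <;> rcases b with n | n | n | _ | _ <;>
    rcases c with p | p | p | _ | _ <;>
    simp only [brGen, parity, hv, ZMod.val_zero, mul_zero, mul_one, pow_zero, pow_one,
      one_smul, neg_zero, smul_zero, map_add, map_neg, map_smul, map_zero, ite_br, br_ite, br_e,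
      LinearMap.add_apply, LinearMap.neg_apply, LinearMap.smul_apply, LinearMap.zero_apply,
      ite_self, add_zero]
  all_goals
    simp only [Int.add_assoc, Int.add_comm, Int.add_left_comm]
    (try split_ifs with h)
    all_goals
      first
        | (have hm : m = -n - p := by omega); subst hm
        | (have hm : m = -n - p - 1 := by omega); subst hm
        | skip
      push_cast
      module

theorem isCompl_part : IsCompl (part 0) (part 1) := by
  have hp (i : ZMod 2) : part i = Finsupp.supported ℂ ℂ {a | parity a = i} := by
    rw [Finsupp.supported_eq_span_single]; rfl
  have hs : {a | parity a = 1} = {a | parity a = 0}ᶜ := by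
    ext a; rcases a <;> simp [parity]
  rw [hp, hp, hs]
  exact ⟨Finsupp.disjoint_supported_supported disjoint_compl_right,
    Finsupp.codisjoint_supported_supported isCompl_compl.codisjoint⟩

noncomputable instance : LieSuperalgebra Alg where
  part := part
  sbr := br
  isCompl := isCompl_part
  sbr_mem i j x y hx hy := by
    refine Submodule.span_induction₂ (p := fun x y _ _ => br x y ∈ part (i + j))
      ?_ ?_ ?_ ?_ ?_ ?_ ?_ hx hy
    · rintro _ _ ⟨a, rfl, rfl⟩ ⟨b, rfl, rfl⟩
      rw [br_e]; exact brGen_mem a b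
    · intro y _; simp
    · intro x _; simp
    · intro x y z _ _ _ h1 h2
      simpa using Submodule.add_mem _ h1 h2
    · intro x y z _ _ _ h1 h2
      simpa using Submodule.add_mem _ h1 h2
    · intro r x y _ _ h
      simpa using Submodule.smul_mem _ r h
    · intro r x y _ _ h
      simpa using Submodule.smul_mem _ r h
  sbr_skew i j x y hx hy := by
    refine Submodule.span_induction₂
      (p := fun x y _ _ => br x y = -((-1 : ℂ) ^ (i.val * j.val) • br y x))
      ?_ ?_ ?_ ?_ ?_ ?_ ?_ hx hy
    · rintro _ _ ⟨a, rfl, rfl⟩ ⟨b, rfl, rfl⟩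
      rw [br_e, br_e]; exact brGen_skew a b
    · intro y _; simp
    · intro x _; simp
    · intro x y z _ _ _ h1 h2
      simp only [map_add, LinearMap.add_apply, h1, h2]; module
    · intro x y z _ _ _ h1 h2
      simp only [map_add, LinearMap.add_apply, h1, h2]; module
    · intro r x y _ _ h
      simp only [map_smul, LinearMap.smul_apply, h]; module
    · intro r x y _ _ h
      simp only [map_smul, LinearMap.smul_apply, h]; module
  sbr_jacobi i j k x y z hx hy hz := by
    clear hz
    refine Submodule.span_induction₂
      (p := fun x y _ _ => br x (br y z) = br (br x y) z
        + (-1 : ℂ) ^ (i.val * j.val) • br y (br x z))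
      ?_ ?_ ?_ ?_ ?_ ?_ ?_ hx hy
    · rintro _ _ ⟨a, rfl, rfl⟩ ⟨b, rfl, rfl⟩
      induction z using Finsupp.induction_linear with
      | zero => simp
      | add f g hf hg => simp only [map_add, hf, hg]; module
      | single c t =>
        have hc : (Finsupp.single c t : Alg) = t • e c := by simp [e]
        simp only [hc, map_smul, br_e, brGen_jacobi a b c]; module
    · intro y _; simp
    · intro x _; simp
    · intro x y z _ _ _ h1 h2
      simp only [map_add, LinearMap.add_apply, h1, h2]; module
    · intro x y z _ _ _ h1 h2
      simp only [map_add, LinearMap.add_apply, h1, h2]; module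
    · intro r x y _ _ h
      simp only [map_smul, LinearMap.smul_apply, h]; module
    · intro r x y _ _ h
      simp only [map_smul, LinearMap.smul_apply, h]; module

/-- The universal enveloping algebra of the N=1 BMS superalgebra. -/
abbrev U : Type := LieSuperalgebra.Env Alg

/-- The image of a basis vector in `U`. -/
noncomputable def u (a : Gen) : U := LieSuperalgebra.toEnv Alg (e a)

/-- The labels of the basis of `g₀ ⊕ g₊`: the vectors `L_n`, `M_n` with `n ≥ 0`, `Q_r` with
`r ≥ 1/2`, and the central elements. -/
def nonneg : Gen → Prop
  | .L n => 0 ≤ n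
  | .M n => 0 ≤ n
  | .Q k => 0 ≤ k
  | .c₁ => True
  | .c₂ => True

/-- The subalgebra `g₀ ⊕ g₊`. -/
noncomputable def borel : Submodule ℂ Alg :=
  Submodule.span ℂ (e '' {a | nonneg a})

/-- The values on basis vectors of the character of `g₀ ⊕ g₊` that sends `L_0, M_0, c₁, c₂` to
`h₁, h₂, z₁, z₂` and `g₊` to `0`. -/
def charGen (h₁ h₂ z₁ z₂ : ℂ) : Gen → ℂ
  | .L n => if n = 0 then h₁ else 0
  | .M n => if n = 0 then h₂ else 0
  | .Q _ => 0
  | .c₁ => z₁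
  | .c₂ => z₂

/-- The linear functional with the values `charGen`; only its restriction to `borel`, the scalar
by which that subalgebra acts on its one-dimensional module, is used. -/
noncomputable def character (h₁ h₂ z₁ z₂ : ℂ) : Alg →ₗ[ℂ] ℂ :=
  Finsupp.linearCombination ℂ (charGen h₁ h₂ z₁ z₂)

/-- The left ideal of `U` generated by the elements `x - χ(x)`, `x ∈ g₀ ⊕ g₊`, where `χ` is the
character above. -/
noncomputable def vermaIdeal (h₁ h₂ z₁ z₂ : ℂ) : Submodule U U :=
  Submodule.span U
    {w | ∃ x ∈ borel, w = LieSuperalgebra.toEnv Alg x - algebraMap ℂ U (character h₁ h₂ z₁ z₂ x)}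

/-- The Verma module `M(h₁, h₂, z₁, z₂) = U(g) ⊗_{U(g₀ ⊕ g₊)} ℂ`, in its usual presentation as the
quotient of `U(g)` by the left ideal `vermaIdeal`. -/
abbrev Verma (h₁ h₂ z₁ z₂ : ℂ) : Type := U ⧸ vermaIdeal h₁ h₂ z₁ z₂

/-- The highest weight vector `1 ⊗ 1` of the Verma module. -/
noncomputable def hwv (h₁ h₂ z₁ z₂ : ℂ) : Verma h₁ h₂ z₁ z₂ :=
  Submodule.Quotient.mk 1

/-- The vacuum module: the quotient of `M(0, 0, z₁, z₂)` by the submodule generated by `L_{-1} 1`. -/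
abbrev Vacuum (z₁ z₂ : ℂ) : Type :=
  Verma 0 0 z₁ z₂ ⧸ Submodule.span U {u (.L (-1)) • hwv 0 0 z₁ z₂}

end BMS

/-! Write 𝟏 for the vacuum vector. The stabiliser, spanned by L_n, M_n (n ≥ -1), Q_r (r ≥ -1/2) and
the centre, acts on 𝟏 by a character, so words in the remaining basis vectors, the letters L_n, M_n
(n ≤ -2) and Q_r (r ≤ -3/2), applied to 𝟏 span the module.

Let c₂ ≠ 0, and give L, Q, M the degrees 1, 0, -1. Modulo lower degree the superbracket is the
central term in c₂, a pairing that matches each letter b with the annihilator `dual b` and is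
nonzero there. To leading order the annihilators are therefore derivatives with respect to the
letters, and `euler`, the normalised sum of the products `dual a * a`, multiplies a word by its
length (`euler_word`). In a nonzero submodule take a nonzero vector of least level. Annihilators
lower the level, so they kill it, and so does `euler`; descent on degree and length then shows that
it is a multiple of 𝟏 (`mem_span_of_euler_eq_zero`, `mem_of_ne_bot`).

Let c₂ = 0. The span of the M_n, Q_r and c₂ is an ideal, and sending it to 0 gives an endomorphism
`toVir` of U that preserves the annihilator of 𝟏. It kills Q_{-3/2}, so Q_{-3/2} 𝟏 cannot generate
𝟏.

Both cases need 𝟏 ≠ 0, the second also Q_{-3/2} 𝟏 ≠ 0. Instead of a PBW theorem, U is made to act on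
the tensor algebra of the letters modulo its enveloping relations (`modelRep`), and two coefficient
functionals are shown to vanish on these relations. -/

namespace BMS

open LieSuperalgebra

/-! ### Signs, generators and maps out of the enveloping algebra -/

/-- The sign `(-1)^{|a||b|}`. -/
noncomputable def sgn (a b : Gen) : ℂ := (-1 : ℂ) ^ ((parity a).val * (parity b).val)

theorem sgn_comm (a b : Gen) : sgn a b = sgn b a := by
  rw [sgn, sgn, mul_comm]

theorem sgn_mul_self (a b : Gen) : sgn a b * sgn a b = 1 := by
  rw [sgn, ← mul_pow]; norm_num

theorem neg_one_pow_add_val (i j k : ZMod 2) :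
    (-1 : ℂ) ^ ((i + j).val * k.val)
      = (-1 : ℂ) ^ (i.val * k.val) * (-1 : ℂ) ^ (j.val * k.val) := by
  have hv : (1 : ZMod 2).val = 1 := rfl
  have h2 : (1 : ZMod 2) + 1 = 0 := by decide
  have h0 (i : ZMod 2) : i = 0 ∨ i = 1 := by revert i; decide
  rcases h0 i with rfl | rfl <;> rcases h0 j with rfl | rfl <;> rcases h0 k with rfl | rfl <;>
    simp [hv, h2]

theorem toEnv_mul_toEnv (i j : ZMod 2) (x y : Alg) (hx : x ∈ part i) (hy : y ∈ part j) :
    toEnv Alg x * toEnv Alg y - (-1 : ℂ) ^ (i.val * j.val) • (toEnv Alg y * toEnv Alg x)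
      = toEnv Alg (br x y) := by
  have := RingQuot.mkAlgHom_rel ℂ (EnvRel.comm (g := Alg) i j x y hx hy)
  simp only [map_sub, map_smul, map_mul] at this
  exact this

theorem u_mul_u (a b : Gen) :
    u a * u b = sgn a b • (u b * u a) + toEnv Alg (brGen a b) := by
  have := toEnv_mul_toEnv _ _ _ _ (e_mem a) (e_mem b)
  rw [br_e] at this
  rw [← this, sgn, u, u]; abel

theorem toEnv_eq (x : Alg) : toEnv Alg x = Finsupp.linearCombination ℂ u x := by
  have : toEnv Alg = Finsupp.linearCombination ℂ u := by
    ext a; simp [u, e]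
  rw [this]

section Lift

variable {A : Type*} [Ring A] [Algebra ℂ A]

theorem superBracket_of_gen (f : Gen → A)
    (h : ∀ a b, f a * f b - sgn a b • (f b * f a) = Finsupp.linearCombination ℂ f (brGen a b))
    (i j : ZMod 2) (x y : Alg) (hx : x ∈ part i) (hy : y ∈ part j) :
    Finsupp.linearCombination ℂ f x * Finsupp.linearCombination ℂ f y
      - (-1 : ℂ) ^ (i.val * j.val)
        • (Finsupp.linearCombination ℂ f y * Finsupp.linearCombination ℂ f x)
      = Finsupp.linearCombination ℂ f (br x y) := by
  induction hx, hy using Submodule.span_induction₂ with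
  | mem_mem x y hx hy =>
    obtain ⟨a, rfl, rfl⟩ := hx
    obtain ⟨b, rfl, rfl⟩ := hy
    rw [br_e, ← h, sgn]; simp [e]
  | zero_left => simp
  | zero_right => simp
  | add_left x y z _ _ _ h1 h2 =>
    simp only [map_add, LinearMap.add_apply, ← h1, ← h2, add_mul, mul_add, smul_add]; abel
  | add_right x y z _ _ _ h1 h2 =>
    simp only [map_add, ← h1, ← h2, add_mul, mul_add, smul_add]; abel
  | smul_left r x y _ _ h1 =>
    simp only [map_smul, LinearMap.smul_apply, ← h1, smul_mul_assoc, mul_smul_comm, smul_sub]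
    rw [smul_comm r]
  | smul_right r x y _ _ h1 =>
    simp only [map_smul, ← h1, smul_mul_assoc, mul_smul_comm, smul_sub]
    rw [smul_comm r]

/-- The algebra map out of `U` with prescribed values on the standard basis. -/
noncomputable def lift (f : Gen → A)
    (h : ∀ a b, f a * f b - sgn a b • (f b * f a) = Finsupp.linearCombination ℂ f (brGen a b)) :
    U →ₐ[ℂ] A :=
  RingQuot.liftAlgHom ℂ ⟨TensorAlgebra.lift ℂ (Finsupp.linearCombination ℂ f), by
    rintro _ _ ⟨i, j, x, y, hx, hy⟩
    simp only [map_sub, map_smul, map_mul, TensorAlgebra.lift_ι_apply]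
    exact superBracket_of_gen f h i j x y hx hy⟩

theorem lift_u (f : Gen → A)
    (h : ∀ a b, f a * f b - sgn a b • (f b * f a) = Finsupp.linearCombination ℂ f (brGen a b))
    (a : Gen) : lift f h (u a) = f a := by
  simp [lift, u, toEnv, e]

end Lift

theorem u_generates : Algebra.adjoin ℂ (Set.range u) = ⊤ := by
  have h1 := TensorAlgebra.adjoin_range_ι (R := ℂ) (M := Alg)
  have h2 := congrArg (Subalgebra.map (RingQuot.mkAlgHom ℂ (EnvRel Alg))) h1
  rw [AlgHom.map_adjoin, Algebra.map_top,
    (AlgHom.range_eq_top _).2 (RingQuot.mkAlgHom_surjective ℂ (EnvRel Alg))] at h2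
  rw [eq_top_iff, ← h2]
  refine Algebra.adjoin_le ?_
  rintro _ ⟨_, ⟨x, rfl⟩, rfl⟩
  change toEnv Alg x ∈ _
  rw [toEnv_eq]
  have hx : Finsupp.linearCombination ℂ u x ∈ Submodule.span ℂ (Set.range u) :=
    Finsupp.range_linearCombination ℂ (v := u) ▸ LinearMap.mem_range_self _ x
  exact Algebra.span_le_adjoin ℂ _ hx

/-! ### The vacuum vector, its stabiliser and its annihilator -/

/-- The labels of the basis of the stabiliser `span (L_n, M_n, Q_r, c₁, c₂ : n ≥ -1, r ≥ -1/2)` of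
the line through the vacuum vector. -/
def inStab : Gen → Prop
  | .L n => -1 ≤ n
  | .M n => -1 ≤ n
  | .Q k => -1 ≤ k
  | .c₁ => True
  | .c₂ => True

section Vacuum

variable (z₁ z₂ : ℂ)

/-- The image of `1 ⊗ 1` in the vacuum module. -/
noncomputable def vac : Vacuum z₁ z₂ := Submodule.Quotient.mk (hwv 0 0 z₁ z₂)

theorem smul_hwv (w : U) : w • hwv 0 0 z₁ z₂ = Submodule.Quotient.mk w := by
  rw [hwv, ← Submodule.Quotient.mk_smul, smul_eq_mul, mul_one]

theorem exists_smul_vac (x : Vacuum z₁ z₂) : ∃ w : U, w • vac z₁ z₂ = x := by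
  obtain ⟨y, rfl⟩ := Submodule.Quotient.mk_surjective _ x
  obtain ⟨w, rfl⟩ := Submodule.Quotient.mk_surjective _ y
  refine ⟨w, ?_⟩
  rw [← smul_hwv, Submodule.Quotient.mk_smul, vac]

theorem u_smul_vac_of_nonneg (a : Gen) (ha : nonneg a) :
    u a • vac z₁ z₂ = charGen 0 0 z₁ z₂ a • vac z₁ z₂ := by
  have h : u a • hwv 0 0 z₁ z₂ = charGen 0 0 z₁ z₂ a • hwv 0 0 z₁ z₂ := by
    rw [smul_hwv, hwv, ← Submodule.Quotient.mk_smul, Submodule.Quotient.eq]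
    refine Submodule.subset_span ⟨e a, Submodule.subset_span ⟨a, ha, rfl⟩, ?_⟩
    rw [← Algebra.algebraMap_eq_smul_one]
    simp [u, character, e]
  rw [vac, ← Submodule.Quotient.mk_smul, h, Submodule.Quotient.mk_smul]

theorem u_L_neg_one_smul_vac : u (.L (-1)) • vac z₁ z₂ = 0 := by
  rw [vac, ← Submodule.Quotient.mk_smul, Submodule.Quotient.mk_eq_zero]
  exact Submodule.subset_span rfl

variable {z₁ z₂} in
/-- A vector on which `g₀ ⊕ g₊` acts by the character and which is killed by `L_{-1}` is an
eigenvector of the whole stabiliser. -/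
theorem u_smul_of_inStab {X : Type*} [AddCommGroup X] [Module ℂ X] [Module U X]
    [IsScalarTower ℂ U X] {v : X} (h0 : ∀ a, nonneg a → u a • v = charGen 0 0 z₁ z₂ a • v)
    (hL : u (.L (-1)) • v = 0) (a : Gen) (ha : inStab a) :
    u a • v = charGen 0 0 z₁ z₂ a • v := by
  by_cases hn : nonneg a
  · exact h0 a hn
  -- Both orders of the product of b and L_{-1} kill v, hence so does [b, L_{-1}]. The choices b =
  -- M_0 and b = Q_{1/2} give M_{-1} and Q_{-1/2}.
  have key (b : Gen) (hb : nonneg b) : toEnv Alg (brGen b (.L (-1))) • v = 0 := by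
    have h := congrArg (· • v) (u_mul_u b (.L (-1)))
    simp only [add_smul, mul_smul, smul_assoc, hL, smul_zero, h0 b hb] at h
    rw [smul_comm (u _) (charGen 0 0 z₁ z₂ b) v, hL, smul_zero, smul_zero, zero_add] at h
    exact h.symm
  rcases a with n | n | n | _ | _ <;> simp only [inStab, nonneg, not_true, not_le] at ha hn
  · obtain rfl : n = -1 := by omega
    simp [hL, charGen]
  · obtain rfl : n = -1 := by omega
    have := key (.M 0) le_rfl
    simpa [brGen, charGen, u] using this
  · obtain rfl : n = -1 := by omega
    have := key (.Q 0) le_rfl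
    norm_num [brGen] at this
    simpa [charGen, u] using this

theorem u_smul_vac (a : Gen) (ha : inStab a) :
    u a • vac z₁ z₂ = charGen 0 0 z₁ z₂ a • vac z₁ z₂ :=
  u_smul_of_inStab (u_smul_vac_of_nonneg z₁ z₂) (u_L_neg_one_smul_vac z₁ z₂) a ha

/-- The universal property of the vacuum module, as a statement on annihilators. -/
theorem apply_eq_zero_of_smul_vac_eq_zero {X : Type*} [AddCommGroup X] [Module ℂ X]
    (φ : U →ₐ[ℂ] Module.End ℂ X) (x : X)
    (hx : ∀ a, inStab a → φ (u a) x = charGen 0 0 z₁ z₂ a • x) (w : U)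
    (hw : w • vac z₁ z₂ = 0) : φ w x = 0 := by
  let K : Submodule U U :=
    { carrier := {w | φ w x = 0}
      add_mem' := fun {a b} ha hb => by simp_all
      zero_mem' := by simp
      smul_mem' := fun c a ha => by simp_all }
  have hK : vermaIdeal 0 0 z₁ z₂ ≤ K := by
    refine Submodule.span_le.2 ?_
    rintro _ ⟨y, hy, rfl⟩
    change φ _ x = 0
    refine Submodule.span_induction (p := fun y _ => φ (toEnv Alg y
      - algebraMap ℂ U (character 0 0 z₁ z₂ y)) x = 0) ?_ ?_ ?_ ?_ hy
    · rintro _ ⟨a, ha, rfl⟩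
      have h1 : φ (toEnv Alg (e a)) x = charGen 0 0 z₁ z₂ a • x := hx a (by
        rcases a with n | n | n | _ | _ <;> simp only [Set.mem_ofPred_eq, nonneg, inStab] at * <;>
          omega)
      rw [map_sub, LinearMap.sub_apply, h1]
      simp [character, e, Module.algebraMap_end_apply]
    · simp
    · intro y z _ _ h1 h2
      simp only [map_add, map_sub, LinearMap.sub_apply, LinearMap.add_apply] at *
      rw [← add_zero (0 : X)]
      nth_rewrite 1 [← h1]
      rw [← h2]; abel
    · intro r y _ h1
      simp only [map_smul, map_sub, LinearMap.sub_apply, LinearMap.smul_apply, smul_eq_mul,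
        map_mul, AlgHom.commutes, Module.algebraMap_end_apply, Module.End.mul_apply] at *
      rw [smul_comm _ r, ← smul_sub, h1, smul_zero]
  have hL : φ (u (.L (-1))) x = 0 := by
    rw [hx _ (by simp [inStab])]; simp [charGen]
  rw [vac, ← Submodule.Quotient.mk_smul, Submodule.Quotient.mk_eq_zero,
    Submodule.mem_span_singleton] at hw
  obtain ⟨r, hr⟩ := hw
  rw [smul_smul, smul_hwv, smul_hwv, Submodule.Quotient.eq] at hr
  have h3 : φ (r * u (.L (-1)) - w) x = 0 := hK hr
  simpa [hL] using h3

end Vacuum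

/-! ### The defect of a linear map and its Jacobi identity -/

section Defect

variable {A : Type*} [Ring A] [Algebra ℂ A] (ρ : Alg →ₗ[ℂ] A)

/-- The failure of a linear map to satisfy the relation `x y - s y x = [x, y]`. -/
noncomputable def defect (s : ℂ) (x y : Alg) : A :=
  ρ x * ρ y - s • (ρ y * ρ x) - ρ (br x y)

theorem brGen_skew' (a b : Gen) : brGen a b = -(sgn a b • brGen b a) := brGen_skew a b

theorem defect_symm (a b : Gen) :
    defect ρ (sgn a b) (e a) (e b) = -(sgn a b • defect ρ (sgn b a) (e b) (e a)) := by
  rw [defect, defect, br_e, br_e, brGen_skew' a b, sgn_comm b a, smul_sub, smul_sub, smul_smul,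
    sgn_mul_self, map_neg, map_smul]
  module

/-- Super Jacobi identity for the defect. -/
theorem defect_jacobi (a b c : Gen) :
    ρ (e a) * defect ρ (sgn b c) (e b) (e c)
      - (sgn a b * sgn a c) • (defect ρ (sgn b c) (e b) (e c) * ρ (e a))
      + defect ρ (sgn a b * sgn a c) (e a) (brGen b c)
    = defect ρ (sgn a b) (e a) (e b) * ρ (e c)
      - (sgn a c * sgn b c) • (ρ (e c) * defect ρ (sgn a b) (e a) (e b))
      + defect ρ (sgn a c * sgn b c) (brGen a b) (e c)
      + sgn a b • (ρ (e b) * defect ρ (sgn a c) (e a) (e c)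
        - (sgn a b * sgn b c) • (defect ρ (sgn a c) (e a) (e c) * ρ (e b))
        + defect ρ (sgn a b * sgn b c) (e b) (brGen a c)) := by
  have hj : br (e a) (brGen b c) = br (brGen a b) (e c) + sgn a b • br (e b) (brGen a c) :=
    brGen_jacobi a b c
  have hs := sgn_mul_self a b
  have h1 (z : ℂ) : sgn a b * (sgn a b * z) = z := by rw [← mul_assoc, hs, one_mul]
  -- The terms cubic in ρ and those mixing ρ with one bracket cancel in any associative algebra; the
  -- double brackets cancel by `hj`.
  simp only [defect, br_e, hj, map_add, map_smul]
  simp only [mul_sub, sub_mul, smul_sub, smul_add, mul_smul_comm, smul_mul_assoc, smul_smul,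
    mul_assoc, h1]
  module

theorem defect_zero_left (s : ℂ) (y : Alg) : defect ρ s 0 y = 0 := by simp [defect]

theorem defect_zero_right (s : ℂ) (x : Alg) : defect ρ s x 0 = 0 := by simp [defect]

theorem defect_add_left (s : ℂ) (x x' y : Alg) :
    defect ρ s (x + x') y = defect ρ s x y + defect ρ s x' y := by
  simp only [defect, map_add, LinearMap.add_apply, add_mul, mul_add]; module

theorem defect_add_right (s : ℂ) (x y y' : Alg) :
    defect ρ s x (y + y') = defect ρ s x y + defect ρ s x y' := by
  simp only [defect, map_add, add_mul, mul_add]; module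

theorem defect_smul_left (s r : ℂ) (x y : Alg) : defect ρ s (r • x) y = r • defect ρ s x y := by
  simp only [defect, map_smul, LinearMap.smul_apply, smul_mul_assoc, mul_smul_comm]; module

theorem defect_smul_right (s r : ℂ) (x y : Alg) : defect ρ s x (r • y) = r • defect ρ s x y := by
  simp only [defect, map_smul, smul_mul_assoc, mul_smul_comm]; module

end Defect

/-! ### A concrete module detecting nonzero vectors -/

section Model

/-- The labels of the basis `L_n, M_n, Q_r` (`n ≤ -2`, `r ≤ -3/2`) of the complement of the
stabiliser of the vacuum line. -/
abbrev Neg : Type := {a : Gen // ¬ inStab a}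

/-- The tensor algebra of the span of the basis vectors with labels in `Neg`. -/
def Words : Type := List Neg →₀ ℂ

noncomputable instance : AddCommGroup Words := inferInstanceAs (AddCommGroup (List Neg →₀ ℂ))

noncomputable instance : Module ℂ Words := inferInstanceAs (Module ℂ (List Neg →₀ ℂ))

/-- The basis of words. -/
noncomputable def wordBasis : Module.Basis (List Neg) ℂ Words :=
  .ofRepr (LinearEquiv.refl ℂ (List Neg →₀ ℂ))

/-- Left multiplication by a letter. -/
noncomputable def cons (b : Neg) : Module.End ℂ Words :=
  wordBasis.constr ℂ fun w => wordBasis (b :: w)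

theorem cons_wordBasis (b : Neg) (w : List Neg) : cons b (wordBasis w) = wordBasis (b :: w) := by
  rw [cons, Module.Basis.constr_basis]

theorem coord_nil_cons (b : Neg) (t : Words) : wordBasis.coord [] (cons b t) = 0 := by
  have : wordBasis.coord [] ∘ₗ cons b = 0 :=
    wordBasis.ext fun w => by simp [cons_wordBasis, Module.Basis.coord_apply]
  exact LinearMap.congr_fun this t

theorem coord_singleton_cons (b c : Neg) (hbc : b = c → False) (t : Words) :
    wordBasis.coord [c] (cons b t) = 0 := by
  have : wordBasis.coord [c] ∘ₗ cons b = 0 :=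
    wordBasis.ext fun w => by
      classical
      simpa [cons_wordBasis, Module.Basis.coord_apply, Finsupp.single_apply] using
        fun h => (hbc h).elim
  exact LinearMap.congr_fun this t

theorem coord_singleton_cons_self (c : Neg) (t : Words) :
    wordBasis.coord [c] (cons c t) = wordBasis.coord [] t := by
  have : wordBasis.coord [c] ∘ₗ cons c = wordBasis.coord [] :=
    wordBasis.ext fun w => by
      classical simp [cons_wordBasis, Module.Basis.coord_apply, Finsupp.single_apply]
  exact LinearMap.congr_fun this t

variable (z₁ z₂ : ℂ)

open Classical in
/-- The action of a basis vector on a word: letters of `Neg` act by left multiplication, the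
stabiliser is moved to the right, where it acts by the character. -/
noncomputable def actWord : List Neg → Gen → Words
  | [], a => if h : inStab a then charGen 0 0 z₁ z₂ a • wordBasis []
      else wordBasis [⟨a, h⟩]
  | b :: w, a => if h : inStab a then
        sgn a b • cons b (actWord w a) + Finsupp.linearCombination ℂ (actWord w) (brGen a b)
      else wordBasis (⟨a, h⟩ :: b :: w)

/-- The linear extension of `actWord`. -/
noncomputable def act : Alg →ₗ[ℂ] Module.End ℂ Words :=
  Finsupp.linearCombination ℂ fun a => wordBasis.constr ℂ fun w => actWord z₁ z₂ w a

theorem act_e_wordBasis (a : Gen) (w : List Neg) :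
    act z₁ z₂ (e a) (wordBasis w) = actWord z₁ z₂ w a := by
  simp [act, e]

theorem act_wordBasis (x : Alg) (w : List Neg) :
    act z₁ z₂ x (wordBasis w) = Finsupp.linearCombination ℂ (actWord z₁ z₂ w) x := by
  have : (act z₁ z₂).flip (wordBasis w) = Finsupp.linearCombination ℂ (actWord z₁ z₂ w) := by
    ext a; simpa [e] using act_e_wordBasis z₁ z₂ a w
  exact LinearMap.congr_fun this x

theorem act_e_neg (b : Neg) : act z₁ z₂ (e b) = cons b := by
  refine wordBasis.ext fun w => ?_
  rw [act_e_wordBasis, cons_wordBasis]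
  cases w <;> simp [actWord, b.2]

theorem act_e_cons (a : Gen) (ha : inStab a) (b : Neg) (t : Words) :
    act z₁ z₂ (e a) (cons b t)
      = sgn a b • cons b (act z₁ z₂ (e a) t) + act z₁ z₂ (brGen a b) t := by
  have : act z₁ z₂ (e a) ∘ₗ cons b
      = sgn a b • (cons b ∘ₗ act z₁ z₂ (e a)) + act z₁ z₂ (brGen a b) := by
    refine wordBasis.ext fun w => ?_
    simp only [LinearMap.comp_apply, LinearMap.add_apply, LinearMap.smul_apply, cons_wordBasis,
      act_e_wordBasis]
    rw [act_wordBasis, actWord.eq_2, dif_pos ha]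
  exact LinearMap.congr_fun this t

theorem act_e_nil (a : Gen) (ha : inStab a) :
    act z₁ z₂ (e a) (wordBasis []) = charGen 0 0 z₁ z₂ a • wordBasis [] := by
  rw [act_e_wordBasis, actWord, dif_pos ha]

theorem defect_apply (s : ℂ) (x y : Alg) (t : Words) :
    defect (A := Module.End ℂ Words) (act z₁ z₂) s x y t = act z₁ z₂ x (act z₁ z₂ y t) - s • act z₁ z₂ y (act z₁ z₂ x t)
      - act z₁ z₂ (br x y) t := rfl

/-- Built into the action: a stabiliser element passes a letter by exactly this relation. -/
theorem defect_stab_neg (a : Gen) (ha : inStab a) (b : Neg) :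
    defect (A := Module.End ℂ Words) (act z₁ z₂) (sgn a b) (e a) (e b) = 0 := by
  refine LinearMap.ext fun t => ?_
  rw [defect_apply, act_e_neg, act_e_cons _ _ a ha, br_e]
  simp

/-- The elements generating the defining relations of the enveloping algebra of the span of `Neg`
as a left ideal stable under right multiplication. -/
inductive IsRelator : Words → Prop
  | base (b c : Neg) (t : Words) : IsRelator (defect (A := Module.End ℂ Words) (act z₁ z₂) (sgn b c) (e b) (e c) t)
  | cons (b : Neg) (t : Words) : IsRelator t → IsRelator (cons b t)

/-- The ideal of relations of the enveloping algebra of the span of `Neg`. -/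
noncomputable def relIdeal : Submodule ℂ Words := Submodule.span ℂ {t | IsRelator z₁ z₂ t}

theorem cons_mem_relIdeal (b : Neg) {t : Words} (ht : t ∈ relIdeal z₁ z₂) :
    cons b t ∈ relIdeal z₁ z₂ := by
  refine Submodule.span_le (p := (relIdeal z₁ z₂).comap (cons b)).2 ?_ ht
  intro t ht
  exact Submodule.subset_span (.cons b t ht)

theorem defect_gen_neg_mem (a : Gen) (b : Neg) (t : Words) :
    defect (A := Module.End ℂ Words) (act z₁ z₂) (sgn a b) (e a) (e b) t ∈ relIdeal z₁ z₂ := by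
  by_cases ha : inStab a
  · simp [defect_stab_neg z₁ z₂ a ha b]
  · exact Submodule.subset_span (.base ⟨a, ha⟩ b t)

theorem defect_neg_gen_mem (a : Gen) (b : Neg) (t : Words) :
    defect (A := Module.End ℂ Words) (act z₁ z₂) (sgn b a) (e b) (e a) t ∈ relIdeal z₁ z₂ := by
  rw [defect_symm, LinearMap.neg_apply, LinearMap.smul_apply]
  exact Submodule.neg_mem _ (Submodule.smul_mem _ _ (defect_gen_neg_mem z₁ z₂ a b t))

theorem sgn_add_left {a b d c : Gen} (h : parity d = parity a + parity b) :
    sgn d c = sgn a c * sgn b c := by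
  rw [sgn, h, neg_one_pow_add_val]; rfl

theorem sgn_add_right {a b d c : Gen} (h : parity d = parity a + parity b) :
    sgn c d = sgn c a * sgn c b := by
  rw [sgn_comm, sgn_add_left h, sgn_comm a, sgn_comm b]

/-- A bracket of basis vectors is homogeneous, so one sign serves all terms of its expansion and the
defect can be expanded linearly. -/
theorem defect_brGen_left_mem (a b c : Gen) (t : Words)
    (h : ∀ d, defect (A := Module.End ℂ Words) (act z₁ z₂) (sgn d c) (e d) (e c) t ∈ relIdeal z₁ z₂) :
    defect (A := Module.End ℂ Words) (act z₁ z₂) (sgn a c * sgn b c) (brGen a b) (e c) t ∈ relIdeal z₁ z₂ := by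
  have h0 := brGen_mem a b
  generalize brGen a b = z at h0 ⊢
  induction h0 using Submodule.span_induction with
  | mem x hx =>
    obtain ⟨d, hd, rfl⟩ := hx
    rw [← sgn_add_left hd]; exact h d
  | zero => rw [defect_zero_left]; exact Submodule.zero_mem _
  | add x y _ _ hx hy =>
    rw [defect_add_left]; exact Submodule.add_mem _ hx hy
  | smul r x _ hx =>
    rw [defect_smul_left]; exact Submodule.smul_mem _ r hx

theorem defect_brGen_right_mem (a b c : Gen) (t : Words)
    (h : ∀ d, defect (A := Module.End ℂ Words) (act z₁ z₂) (sgn c d) (e c) (e d) t ∈ relIdeal z₁ z₂) :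
    defect (A := Module.End ℂ Words) (act z₁ z₂) (sgn c a * sgn c b) (e c) (brGen a b) t ∈ relIdeal z₁ z₂ := by
  have h0 := brGen_mem a b
  generalize brGen a b = z at h0 ⊢
  induction h0 using Submodule.span_induction with
  | mem x hx =>
    obtain ⟨d, hd, rfl⟩ := hx
    rw [← sgn_add_right hd]; exact h d
  | zero => rw [defect_zero_right]; exact Submodule.zero_mem _
  | add x y _ _ hx hy =>
    rw [defect_add_right]; exact Submodule.add_mem _ hx hy
  | smul r x _ hx =>
    rw [defect_smul_right]; exact Submodule.smul_mem _ r hx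

/-- The character of the stabiliser vanishes on brackets. -/
theorem act_brGen_nil (a b : Gen) (ha : inStab a) (hb : inStab b) :
    act z₁ z₂ (brGen a b) (wordBasis []) = 0 := by
  let K : Submodule ℂ Alg := LinearMap.ker ((act z₁ z₂).flip (wordBasis []))
  have hL (n : ℤ) (r : ℂ) (h : n < -1 → r = 0) : r • e (.L n) ∈ K := by
    by_cases hn : inStab (.L n)
    · simp [K, act_e_nil _ _ _ hn, charGen]
    · simp [h (not_le.1 hn)]
  have hM (n : ℤ) (r : ℂ) (h : n < -1 → r = 0) : r • e (.M n) ∈ K := by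
    by_cases hn : inStab (.M n)
    · simp [K, act_e_nil _ _ _ hn, charGen]
    · simp [h (not_le.1 hn)]
  have hQ (n : ℤ) (r : ℂ) (h : n < -1 → r = 0) : r • e (.Q n) ∈ K := by
    by_cases hn : inStab (.Q n)
    · simp [K, act_e_nil _ _ _ hn, charGen]
    · simp [h (not_le.1 hn)]
  have hC (p : Prop) [Decidable p] (c : Gen) (r : ℂ) (h : p → r = 0) :
      (if p then r • e c else 0) ∈ K := by
    split_ifs with hp
    · simp [h hp]
    · exact K.zero_mem
  -- Since h₁ = h₂ = 0, only two things could fail: a bracket leaving the stabiliser, which needs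
  -- both indices -1, where the structure constant is 0; or a central term, whose cubic or quadratic
  -- coefficient vanishes on the indices allowed here.
  have h1 {m n : ℤ} (hm : -1 ≤ m) (hn : -1 ≤ n) (h : m + n < -1) : m = -1 ∧ n = -1 := by omega
  have h2 {m n : ℤ} (hm : -1 ≤ m) (hn : -1 ≤ n) (h : m + n = 0) : ((m : ℂ) ^ 3 - m) / 12 = 0 := by
    have : m ≤ 1 := by omega
    interval_cases m <;> norm_num
  suffices h : brGen a b ∈ K from h
  rcases a with m | m | m | _ | _ <;> rcases b with n | n | n | _ | _ <;>
    simp only [brGen, inStab] at * <;> try exact K.zero_mem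
  · refine K.add_mem (hL _ _ fun h => ?_) (hC _ _ _ (h2 ha hb))
    obtain ⟨rfl, rfl⟩ := h1 ha hb h; norm_num
  · refine K.add_mem (hM _ _ fun h => ?_) (hC _ _ _ (h2 ha hb))
    obtain ⟨rfl, rfl⟩ := h1 ha hb h; norm_num
  · refine hQ _ _ fun h => ?_
    obtain ⟨rfl, rfl⟩ := h1 ha hb h; norm_num
  · refine K.neg_mem (K.add_mem (hM _ _ fun h => ?_) (hC _ _ _ (h2 hb ha)))
    obtain ⟨rfl, rfl⟩ := h1 hb ha h; norm_num
  · refine K.neg_mem (hQ _ _ fun h => ?_)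
    obtain ⟨rfl, rfl⟩ := h1 hb ha h; norm_num
  · refine K.add_mem (hM _ _ fun h => by omega) (hC _ _ _ fun h => ?_)
    have : m ≤ 0 := by omega
    interval_cases m <;> norm_num

theorem defect_stab_nil (a b : Gen) (ha : inStab a) (hb : inStab b) :
    defect (A := Module.End ℂ Words) (act z₁ z₂) (sgn a b) (e a) (e b) (wordBasis []) = 0 := by
  rw [defect_apply, br_e, act_brGen_nil z₁ z₂ a b ha hb, act_e_nil _ _ a ha, act_e_nil _ _ b hb,
    map_smul, map_smul, act_e_nil _ _ a ha, act_e_nil _ _ b hb]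
  have hv : (1 : ZMod 2).val = 1 := rfl
  rcases a with m | m | m | _ | _ <;> rcases b with n | n | n | _ | _ <;>
    simp only [charGen, sgn, parity, hv, ZMod.val_zero, mul_zero, zero_mul, pow_zero] <;> module

/-- Induction on the word. For a, b in the stabiliser and first letter c, the Jacobi identity, in
which the defects of (a, c) and (b, c) vanish, expresses the defect of (a, b) on c·w through c times
that defect on w, defects on the shorter word w, and a defect paired with the letter c, which is a
relator. -/
theorem defect_mem (t : Words) (a b : Gen) :
    defect (A := Module.End ℂ Words) (act z₁ z₂) (sgn a b) (e a) (e b) t ∈ relIdeal z₁ z₂ := by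
  suffices h : ∀ (w : List Neg) (a b : Gen),
      defect (A := Module.End ℂ Words) (act z₁ z₂) (sgn a b) (e a) (e b) (wordBasis w)
        ∈ relIdeal z₁ z₂ by
    have h2 : (⊤ : Submodule ℂ Words) ≤ (relIdeal z₁ z₂).comap
        (defect (A := Module.End ℂ Words) (act z₁ z₂) (sgn a b) (e a) (e b)) := by
      rw [← wordBasis.span_eq, Submodule.span_le]
      rintro _ ⟨w, rfl⟩
      exact h w a b
    exact h2 Submodule.mem_top
  intro w a b
  induction w generalizing a b with
  | nil =>
    by_cases ha : inStab a
    · by_cases hb : inStab b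
      · rw [defect_stab_nil z₁ z₂ a b ha hb]; exact Submodule.zero_mem _
      · exact defect_gen_neg_mem z₁ z₂ a ⟨b, hb⟩ _
    · exact defect_neg_gen_mem z₁ z₂ b ⟨a, ha⟩ _
  | cons c w ih =>
    by_cases hb : inStab b
    swap
    · exact defect_gen_neg_mem z₁ z₂ a ⟨b, hb⟩ _
    by_cases ha : inStab a
    swap
    · exact defect_neg_gen_mem z₁ z₂ b ⟨a, ha⟩ _
    have hJ := LinearMap.congr_fun (defect_jacobi (A := Module.End ℂ Words) (act z₁ z₂) a b c) (wordBasis w)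
    rw [defect_stab_neg z₁ z₂ a ha c, defect_stab_neg z₁ z₂ b hb c, act_e_neg] at hJ
    simp only [mul_zero, zero_mul, smul_zero, sub_zero, zero_add, LinearMap.add_apply,
      LinearMap.sub_apply, LinearMap.smul_apply, Module.End.mul_apply, cons_wordBasis,
      sub_zero, zero_add] at hJ
    have h1 := defect_brGen_right_mem z₁ z₂ b c a _ fun d => ih a d
    have h2 := defect_brGen_left_mem z₁ z₂ a b c (wordBasis w)
      fun d => defect_gen_neg_mem z₁ z₂ d c _
    have h3 := defect_brGen_right_mem z₁ z₂ a c b _ fun d => ih b d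
    rw [sgn_comm b a] at h3
    have h4 := cons_mem_relIdeal z₁ z₂ c (ih a b)
    have h5 := Submodule.sub_mem _ (Submodule.add_mem _ (Submodule.sub_mem _ h1
      (Submodule.smul_mem _ (sgn a b) h3)) (Submodule.smul_mem _ (sgn a c * sgn b c) h4)) h2
    convert h5 using 1
    rw [hJ]; module

/-- A stabiliser element applied to a defect of two letters is, by the Jacobi identity, a
combination of defects, all in the ideal by `defect_mem`. Past a further letter it moves at the cost
of a bracket, which is why the induction runs over all `x` at once. -/
theorem act_mem_relIdeal (x : Alg) {t : Words} (ht : t ∈ relIdeal z₁ z₂) :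
    act z₁ z₂ x t ∈ relIdeal z₁ z₂ := by
  have hx (x : Alg) (t : Words) (h : ∀ a, act z₁ z₂ (e a) t ∈ relIdeal z₁ z₂) :
      act z₁ z₂ x t ∈ relIdeal z₁ z₂ := by
    induction x using Finsupp.induction_linear with
    | zero => simp
    | add f g hf hg => rw [map_add]; exact Submodule.add_mem _ hf hg
    | single a r =>
      rw [← mul_one r, ← smul_eq_mul, ← Finsupp.smul_single, map_smul]
      exact Submodule.smul_mem _ r (h a)
  refine Submodule.span_le (p := (relIdeal z₁ z₂).comap (act z₁ z₂ x)).2 ?_ ht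
  intro t ht
  change IsRelator z₁ z₂ t at ht
  change act z₁ z₂ x t ∈ relIdeal z₁ z₂
  induction ht generalizing x with
  | base b c t =>
    refine hx _ _ fun a => ?_
    by_cases ha : inStab a
    swap
    · rw [act_e_neg z₁ z₂ ⟨a, ha⟩]
      exact cons_mem_relIdeal z₁ z₂ _ (defect_mem z₁ z₂ _ _ _)
    have hJ := LinearMap.congr_fun (defect_jacobi (A := Module.End ℂ Words) (act z₁ z₂) a b c) t
    rw [defect_stab_neg z₁ z₂ a ha c, defect_stab_neg z₁ z₂ a ha b] at hJ
    simp only [mul_zero, zero_mul, smul_zero, sub_zero, zero_add, LinearMap.add_apply,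
      LinearMap.sub_apply, LinearMap.smul_apply, Module.End.mul_apply, smul_zero, sub_zero,
      zero_add] at hJ
    rw [sub_add_eq_add_sub, sub_eq_iff_eq_add, ← eq_sub_iff_add_eq] at hJ
    rw [hJ]
    have h3 := defect_brGen_right_mem z₁ z₂ a c b t fun d => defect_mem z₁ z₂ _ _ _
    rw [sgn_comm b a] at h3
    exact Submodule.sub_mem _ (Submodule.add_mem _ (Submodule.add_mem _
      (defect_brGen_left_mem z₁ z₂ a b c t fun d => defect_mem z₁ z₂ _ _ _)
      (Submodule.smul_mem _ _ h3)) (Submodule.smul_mem _ _ (defect_mem z₁ z₂ _ _ _)))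
      (defect_brGen_right_mem z₁ z₂ b c a t fun d => defect_mem z₁ z₂ _ _ _)
  | cons b t ht ih =>
    refine hx _ _ fun a => ?_
    by_cases ha : inStab a
    swap
    · rw [act_e_neg z₁ z₂ ⟨a, ha⟩]
      exact cons_mem_relIdeal z₁ z₂ _ (Submodule.subset_span (.cons b t ht))
    rw [act_e_cons z₁ z₂ a ha]
    refine Submodule.add_mem _ (Submodule.smul_mem _ _ (cons_mem_relIdeal z₁ z₂ _ ?_)) ?_
    · exact ih _
    · exact ih _

/-- Brackets add L_0-weights and every letter has weight at least 3/2, so Q_{-3/2}, of weight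
exactly 3/2, is never reached. -/
theorem brGen_neg_mem (b c : Neg) :
    brGen b c ∈ Submodule.span ℂ (e '' {d | ¬ inStab d ∧ d ≠ .Q (-2)}) := by
  set K := Submodule.span ℂ (e '' {d | ¬ inStab d ∧ d ≠ .Q (-2)})
  have hK (d : Gen) (h1 : ¬ inStab d) (h2 : d ≠ .Q (-2)) : e d ∈ K :=
    Submodule.subset_span ⟨d, ⟨h1, h2⟩, rfl⟩
  have hL (n : ℤ) (r : ℂ) (h : n < -2) : r • e (.L n) ∈ K :=
    K.smul_mem _ (hK _ (by simp only [inStab]; omega) (by simp))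
  have hM (n : ℤ) (r : ℂ) (h : n < -2) : r • e (.M n) ∈ K :=
    K.smul_mem _ (hK _ (by simp only [inStab]; omega) (by simp))
  have hQ (n : ℤ) (r : ℂ) (h : n < -2) : r • e (.Q n) ∈ K :=
    K.smul_mem _ (hK _ (by simp only [inStab]; omega) (by simp; omega))
  have hC (p : Prop) [Decidable p] (x : Alg) (h : ¬ p) : (if p then x else 0) ∈ K := by
    simp [h]
  obtain ⟨b, hb⟩ := b
  obtain ⟨c, hc⟩ := c
  change brGen b c ∈ K
  rcases b with m | m | m | _ | _ <;> rcases c with n | n | n | _ | _ <;>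
    simp only [inStab, not_true, not_le] at hb hc <;> simp only [brGen] <;>
    try exact K.zero_mem
  · exact K.add_mem (hL _ _ (by omega)) (hC _ _ (by omega))
  · exact K.add_mem (hM _ _ (by omega)) (hC _ _ (by omega))
  · exact hQ _ _ (by omega)
  · exact K.neg_mem (K.add_mem (hM _ _ (by omega)) (hC _ _ (by omega)))
  · exact K.neg_mem (hQ _ _ (by omega))
  · exact K.add_mem (hM _ _ (by omega)) (hC _ _ (by omega))

/-- The letter `Q_{-3/2}`. -/
def lowestQ : Neg := ⟨.Q (-2), by simp [inStab]⟩

theorem coord_act_brGen (b c : Neg) (t : Words) :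
    wordBasis.coord [] (act z₁ z₂ (brGen b c) t) = 0 ∧
      wordBasis.coord [lowestQ] (act z₁ z₂ (brGen b c) t) = 0 := by
  have h0 := brGen_neg_mem b c
  generalize brGen b c = z at h0 ⊢
  induction h0 using Submodule.span_induction with
  | mem x hx =>
    obtain ⟨d, ⟨h1, h2⟩, rfl⟩ := hx
    rw [act_e_neg z₁ z₂ ⟨d, h1⟩]
    exact ⟨coord_nil_cons _ _, coord_singleton_cons _ _ (fun h => h2 (congrArg Subtype.val h)) _⟩
  | zero => simp
  | add x y _ _ hx hy => simp only [map_add, LinearMap.add_apply, hx, hy, add_zero, and_self]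
  | smul r x _ hx => simp only [map_smul, LinearMap.smul_apply, hx, smul_zero, and_self]

/-- The quadratic part of a relator has no words of length below two, and its bracket part starts
with a letter other than Q_{-3/2}. The constant coefficient is carried along because prefixing
Q_{-3/2} turns it into the other one. -/
theorem coord_eq_zero_of_mem_relIdeal {t : Words} (ht : t ∈ relIdeal z₁ z₂) :
    wordBasis.coord [] t = 0 ∧ wordBasis.coord [lowestQ] t = 0 := by
  have h : relIdeal z₁ z₂ ≤ LinearMap.ker (wordBasis.coord [])
      ⊓ LinearMap.ker (wordBasis.coord [lowestQ]) := by
    refine Submodule.span_le.2 fun t ht => ?_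
    change wordBasis.coord [] t = 0 ∧ wordBasis.coord [lowestQ] t = 0
    induction ht with
    | base b c t =>
      obtain ⟨h1, h2⟩ := coord_act_brGen z₁ z₂ b c t
      have hs (b c : Neg) (t : Words) : wordBasis.coord [lowestQ] (cons b (cons c t)) = 0 := by
        by_cases h : b = lowestQ
        · rw [h, coord_singleton_cons_self, coord_nil_cons]
        · exact coord_singleton_cons _ _ h _
      simp only [defect_apply, br_e, act_e_neg, map_sub, map_smul, coord_nil_cons, hs, h1, h2,
        smul_zero, sub_zero, and_self]
    | cons b t _ ih =>
      refine ⟨coord_nil_cons _ _, ?_⟩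
      by_cases h : b = lowestQ
      · rw [h, coord_singleton_cons_self, ih.1]
      · exact coord_singleton_cons _ _ h _
  exact h ht

/-- The action of `U` on the enveloping algebra of the span of `Neg`. -/
noncomputable def modelRep : U →ₐ[ℂ] Module.End ℂ (Words ⧸ relIdeal z₁ z₂) :=
  lift (fun a => (relIdeal z₁ z₂).mapQ (relIdeal z₁ z₂) (act z₁ z₂ (e a))
      fun _ => act_mem_relIdeal z₁ z₂ (e a)) fun a b => by
    refine LinearMap.ext fun y => ?_
    obtain ⟨t, rfl⟩ := Submodule.Quotient.mk_surjective _ y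
    have h1 (x : Alg) : Finsupp.linearCombination ℂ
        (fun a => (relIdeal z₁ z₂).mapQ (relIdeal z₁ z₂) (act z₁ z₂ (e a))
          fun _ => act_mem_relIdeal z₁ z₂ (e a)) x (Submodule.Quotient.mk t)
        = Submodule.Quotient.mk (act z₁ z₂ x t) := by
      induction x using Finsupp.induction_linear with
      | zero => simp
      | add f g hf hg => simp [hf, hg]
      | single a r =>
        rw [← mul_one r, ← smul_eq_mul, ← Finsupp.smul_single, map_smul, map_smul]
        simp [e]
    rw [h1, LinearMap.sub_apply, LinearMap.smul_apply, Module.End.mul_apply, Module.End.mul_apply]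
    simp only [Submodule.mapQ_apply, ← Submodule.Quotient.mk_smul, ← Submodule.Quotient.mk_sub]
    rw [Submodule.Quotient.eq, ← br_e]
    exact defect_mem z₁ z₂ t a b

theorem modelRep_u (a : Gen) (t : Words) :
    modelRep z₁ z₂ (u a) (Submodule.Quotient.mk t) = Submodule.Quotient.mk (act z₁ z₂ (e a) t) := by
  rw [modelRep, lift_u, Submodule.mapQ_apply]

theorem modelRep_eq_zero (w : U) (hw : w • vac z₁ z₂ = 0) :
    modelRep z₁ z₂ w (Submodule.Quotient.mk (wordBasis [])) = 0 :=
  apply_eq_zero_of_smul_vac_eq_zero z₁ z₂ _ _ (fun a ha => by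
    rw [modelRep_u, act_e_nil _ _ a ha, Submodule.Quotient.mk_smul]) w hw

end Model

theorem vac_ne_zero (z₁ z₂ : ℂ) : vac z₁ z₂ ≠ 0 := by
  intro h
  have h1 := modelRep_eq_zero z₁ z₂ 1 (by rw [one_smul, h])
  rw [map_one, Module.End.one_apply, Submodule.Quotient.mk_eq_zero] at h1
  have := (coord_eq_zero_of_mem_relIdeal z₁ z₂ h1).1
  simp [Module.Basis.coord_apply] at this

theorem u_Q_smul_vac_ne_zero (z₁ z₂ : ℂ) : u (.Q (-2)) • vac z₁ z₂ ≠ 0 := by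
  intro h
  have h1 := modelRep_eq_zero z₁ z₂ _ h
  rw [modelRep_u, show Gen.Q (-2) = lowestQ from rfl, act_e_neg, cons_wordBasis, Submodule.Quotient.mk_eq_zero] at h1
  have := (coord_eq_zero_of_mem_relIdeal z₁ z₂ h1).2
  simp [Module.Basis.coord_apply] at this

/-! ### Degree, level and the leading pairing -/

/-- The degree with `|L| = 1`, `|Q| = 0`, `|M| = -1`. For the filtration of `U` by this degree, the
leading part of the superbracket is the pairing given by the coefficient of `c₂`. -/
def deg : Gen → ℤ
  | .L _ => 1
  | .M _ => -1
  | _ => 0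

/-- Twice the `L_0`-weight. -/
def lvl : Gen → ℤ
  | .L n => -2 * n
  | .M n => -2 * n
  | .Q k => -(2 * k + 1)
  | _ => 0

/-- The label of the basis vector paired with a given one. -/
def dual : Gen → Gen
  | .L n => .M (-n)
  | .M n => .L (-n)
  | .Q k => .Q (-k - 1)
  | a => a

theorem dual_dual (a : Gen) : dual (dual a) = a := by
  rcases a with n | n | n | _ | _ <;> simp [dual]

theorem parity_dual (a : Gen) : parity (dual a) = parity a := by
  rcases a with n | n | n | _ | _ <;> rfl

theorem deg_dual (a : Gen) : deg (dual a) = -deg a := by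
  rcases a with n | n | n | _ | _ <;> rfl

theorem lvl_dual (a : Gen) : lvl (dual a) = -lvl a := by
  rcases a with n | n | n | _ | _ <;> simp [dual, lvl]; ring

theorem three_le_lvl {a : Gen} (ha : ¬ inStab a) : 3 ≤ lvl a := by
  rcases a with n | n | n | _ | _ <;> simp only [inStab, lvl, not_true] at * <;> omega

theorem neg_one_le_deg (a : Gen) : -1 ≤ deg a := by
  rcases a with n | n | n | _ | _ <;> simp [deg]

/-- The leading part of the bracket. -/
noncomputable def pairing (a b : Gen) : ℂ := brGen a b .c₂

/-- [L, L], [L, Q] and the M-terms of [L, M] and [Q, Q] all lose at least one degree. Only c₂,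
occurring in [L, M] and [Q, Q], keeps the full degree 0. -/
theorem brGen_sub_pairing_mem (a b : Gen) : brGen a b - pairing a b • e .c₂
    ∈ Submodule.span ℂ (e '' {c | deg c ≤ deg a + deg b - 1 ∧ lvl c = lvl a + lvl b}) := by
  set K := Submodule.span ℂ (e '' {c | deg c ≤ deg a + deg b - 1 ∧ lvl c = lvl a + lvl b})
  have hK (c : Gen) (h : deg c ≤ deg a + deg b - 1 ∧ lvl c = lvl a + lvl b) (r : ℂ) :
      r • e c ∈ K := K.smul_mem _ (Submodule.subset_span ⟨c, h, rfl⟩)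
  have h1 (p : Prop) [Decidable p] (x y : Alg) (hp : p → y ∈ K) (hx : x ∈ K) :
      x + (if p then y else 0) ∈ K := by
    split_ifs with h
    · exact K.add_mem hx (hp h)
    · simpa using hx
  have h2 (p : Prop) [Decidable p] (c : Gen) (r s : ℂ) (hc : c ≠ .c₂) :
      s • e c + (if p then r • e .c₂ else 0)
        - (s • e c + (if p then r • e .c₂ else 0) : Alg) .c₂ • e .c₂ = s • e c := by
    split_ifs <;> simp [e, hc]
  have h3 (p : Prop) [Decidable p] (c : Gen) (r s : ℂ) (hc : c ≠ .c₂) :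
      -(s • e c + (if p then r • e .c₂ else 0))
        - (-(s • e c + (if p then r • e .c₂ else 0)) : Alg) .c₂ • e .c₂ = -(s • e c) := by
    split_ifs <;> simp [e, hc]
  have h4 (c : Gen) (s : ℂ) (hc : c ≠ .c₂) : s • e c - (s • e c : Alg) .c₂ • e .c₂ = s • e c := by
    simp [e, hc]
  have h5 (c : Gen) (s : ℂ) (hc : c ≠ .c₂) :
      -(s • e c) - (-(s • e c) : Alg) .c₂ • e .c₂ = -(s • e c) := by
    simp [e, hc]
  have h6 : (0 : Alg) - (0 : Alg) .c₂ • e .c₂ ∈ K := by simp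
  rcases a with m | m | m | _ | _ <;> rcases b with n | n | n | _ | _ <;>
    simp only [pairing, brGen] <;> try exact h6
  · rw [show (((m : ℂ) - n) • e (.L (m + n)) + if m + n = 0 then (((m : ℂ) ^ 3 - m) / 12) • e .c₁
      else 0 : Alg) .c₂ = 0 by split_ifs <;> simp [e], zero_smul, sub_zero]
    refine h1 _ _ _ (fun h => hK _ ?_ _) (hK _ ?_ _) <;> simp only [deg, lvl] <;> omega
  · rw [h2 _ _ _ _ (by simp)]
    refine hK _ ?_ _; simp only [deg, lvl]; omega
  · rw [h4 _ _ (by simp)]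
    refine hK _ ?_ _; simp only [deg, lvl]; omega
  · rw [h3 _ _ _ _ (by simp)]
    refine K.neg_mem (hK _ ?_ _); simp only [deg, lvl]; omega
  · rw [h5 _ _ (by simp)]
    refine K.neg_mem (hK _ ?_ _); simp only [deg, lvl]; omega
  · rw [h2 _ _ _ _ (by simp)]
    refine hK _ ?_ _; simp only [deg, lvl]; omega

theorem pairing_eq_zero (a b : Gen) (hab : b ≠ dual a) : pairing a b = 0 := by
  rcases a with m | m | m | _ | _ <;> rcases b with n | n | n | _ | _ <;>
    simp only [pairing, brGen, dual, ne_eq, Gen.M.injEq, Gen.L.injEq, Gen.Q.injEq] at * <;>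
    first
      | rfl
      | (split_ifs <;> first | omega | simp [e])
      | simp [e]

/-- The values are -m(m²-1)/12 and k(k+1)/3, with zeros at m = -1, 0, 1 and k = -1, 0; the indices
of letters are at most -2. -/
theorem pairing_dual_ne_zero {b : Gen} (hb : ¬ inStab b) : pairing (dual b) b ≠ 0 := by
  have cast_ne (m : ℤ) (h : m ≠ 0) : (m : ℂ) ≠ 0 := by exact_mod_cast h
  rcases b with m | m | m | _ | _ <;>
    simp only [inStab, not_true, not_le, pairing, dual] at *
  · have h : brGen (.M (-m)) (.L m) .c₂ = ((-m * (m - 1) * (m + 1) : ℤ) : ℂ) / 12 := by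
      simp [brGen, e]; ring
    rw [h]
    exact div_ne_zero (cast_ne _ (mul_ne_zero (mul_ne_zero (by omega) (by omega)) (by omega)))
      (by norm_num)
  · have h : brGen (.L (-m)) (.M m) .c₂ = ((-m * (m - 1) * (m + 1) : ℤ) : ℂ) / 12 := by
      simp [brGen, e]; ring
    rw [h]
    exact div_ne_zero (cast_ne _ (mul_ne_zero (mul_ne_zero (by omega) (by omega)) (by omega)))
      (by norm_num)
  · have h : brGen (.Q (-m - 1)) (.Q m) .c₂ = ((m * (m + 1) : ℤ) : ℂ) / 3 := by
      rw [brGen, if_pos (by omega)]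
      simp only [e, Finsupp.add_apply, Finsupp.smul_apply, smul_eq_mul, Finsupp.single_eq_same]
      rw [Finsupp.single_eq_of_ne (by simp)]
      push_cast; ring
    rw [h]
    exact div_ne_zero (cast_ne _ (mul_ne_zero (by omega) (by omega))) (by norm_num)

/-! ### The filtration of the module by degree and level -/

section Filtration

variable {X : Type*} [AddCommGroup X] [Module ℂ X] [Module U X] [IsScalarTower ℂ U X] (v : X)

/-- The vector obtained from `v` by applying a word. -/
noncomputable def word (w : List Gen) : X := w.foldr (fun a x => u a • x) v

/-- The span of the vectors obtained from `v` by words in the basis vectors outside the stabiliser,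
of bounded degree and level. -/
noncomputable def filt (d D : ℤ) : Submodule ℂ X :=
  Submodule.span ℂ {x | ∃ w : List Gen, (∀ a ∈ w, ¬ inStab a) ∧ (w.map deg).sum ≤ d ∧
    (w.map lvl).sum ≤ D ∧ x = word v w}

omit [IsScalarTower ℂ U X] in
theorem filt_mono {d d' D D' : ℤ} (h : d ≤ d') (h' : D ≤ D') : filt v d D ≤ filt v d' D' :=
  Submodule.span_mono fun _ ⟨w, h1, h2, h3, h4⟩ => ⟨w, h1, h2.trans h, h3.trans h', h4⟩

omit [IsScalarTower ℂ U X] in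
theorem word_mem_filt {w : List Gen} (hw : ∀ a ∈ w, ¬ inStab a) :
    word v w ∈ filt v (w.map deg).sum (w.map lvl).sum :=
  Submodule.subset_span ⟨w, hw, le_rfl, le_rfl, rfl⟩

theorem u_smul_mem_of_forall_word {K : Submodule ℂ X} {a : Gen} {d D : ℤ}
    (h : ∀ w : List Gen, (∀ a ∈ w, ¬ inStab a) → (w.map deg).sum ≤ d → (w.map lvl).sum ≤ D →
      u a • word v w ∈ K) {x : X} (hx : x ∈ filt v d D) : u a • x ∈ K := by
  induction hx using Submodule.span_induction with
  | mem x hx => obtain ⟨w, h1, h2, h3, rfl⟩ := hx; exact h w h1 h2 h3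
  | zero => simp
  | add x y _ _ hx hy => rw [smul_add]; exact K.add_mem hx hy
  | smul r x _ hx => rw [smul_comm]; exact K.smul_mem _ hx

theorem toEnv_smul_mem {K : Submodule ℂ X} {S : Set Gen} {x : X} (h : ∀ c ∈ S, u c • x ∈ K)
    {z : Alg} (hz : z ∈ Submodule.span ℂ (e '' S)) : toEnv Alg z • x ∈ K := by
  induction hz using Submodule.span_induction with
  | mem z hz => obtain ⟨c, hc, rfl⟩ := hz; exact h c hc
  | zero => simp
  | add y z _ _ hy hz => rw [map_add, add_smul]; exact K.add_mem hy hz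
  | smul r z _ hz => rw [map_smul, smul_assoc]; exact K.smul_mem _ hz

theorem toEnv_brGen_smul (a b : Gen) (x : X) : toEnv Alg (brGen a b) • x
    = pairing a b • u .c₂ • x + toEnv Alg (brGen a b - pairing a b • e .c₂) • x := by
  rw [map_sub, map_smul, sub_smul, smul_assoc]
  simp [u]

theorem u_smul_u_smul (a b : Gen) (x : X) :
    u a • u b • x = sgn a b • u b • u a • x + toEnv Alg (brGen a b) • x := by
  rw [smul_smul, u_mul_u, add_smul, smul_assoc, mul_smul]

variable {v} {z₁ z₂ : ℂ} (hv : ∀ a, inStab a → u a • v = charGen 0 0 z₁ z₂ a • v)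
include hv

theorem u_c_two_smul_word (w : List Gen) : u .c₂ • word v w = z₂ • word v w := by
  induction w with
  | nil => exact hv .c₂ trivial
  | cons b w ih =>
    change u .c₂ • u b • word v w = z₂ • u b • word v w
    rw [u_smul_u_smul, ih, smul_comm (u b) z₂]
    simp [sgn, parity, brGen]

theorem u_c_two_smul {d D : ℤ} {x : X} (hx : x ∈ filt v d D) : u .c₂ • x = z₂ • x := by
  induction hx using Submodule.span_induction with
  | mem x hx => obtain ⟨w, h1, h2, h3, rfl⟩ := hx; exact u_c_two_smul_word hv w
  | zero => simp
  | add x y _ _ hx hy => rw [smul_add, smul_add, hx, hy]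
  | smul r x _ hx => rw [smul_comm, hx, smul_comm]

/-- Moving a stabiliser element to the right creates only brackets, whose degree is at most the sum
of the degrees and whose level is the sum of the levels. -/
theorem u_smul_word_mem (w : List Gen) (hw : ∀ a ∈ w, ¬ inStab a) (a : Gen) :
    u a • word v w ∈ filt v ((w.map deg).sum + deg a) ((w.map lvl).sum + lvl a) := by
  induction w generalizing a with
  | nil =>
    by_cases ha : inStab a
    · change u a • v ∈ _
      rw [hv a ha]
      by_cases h0 : charGen 0 0 z₁ z₂ a = 0
      · simp [h0]
      -- A nonzero character value leaves only c₁ and c₂, of degree and level 0.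
      refine Submodule.smul_mem _ _ (filt_mono v ?_ ?_ (word_mem_filt v (w := []) (by simp))) <;>
        rcases a with n | n | n | _ | _ <;> simp [charGen, deg, lvl] at h0 ⊢
    · exact filt_mono v (by simp) (by simp) (word_mem_filt v (w := [a]) (by simpa using ha))
  | cons b w ih =>
    by_cases ha : inStab a
    swap
    · exact filt_mono v (by simp; omega) (by simp; omega) (word_mem_filt v (w := a :: b :: w)
        (by simpa using ⟨ha, by simpa using hw⟩))
    have hb := hw b (by simp)
    have hw' : ∀ a ∈ w, ¬ inStab a := fun a h => hw a (by simp [h])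
    change u a • u b • word v w ∈ _
    rw [u_smul_u_smul, toEnv_brGen_smul]
    refine Submodule.add_mem _ (Submodule.smul_mem _ _ ?_) (Submodule.add_mem _ ?_ ?_)
    · refine u_smul_mem_of_forall_word v (fun w' h1 h2 h3 => ?_) (ih hw' a)
      refine filt_mono v ?_ ?_ (word_mem_filt v (w := b :: w') (by simpa using ⟨hb, h1⟩)) <;>
        simp only [List.map_cons, List.sum_cons] <;> omega
    · by_cases h : b = dual a
      · refine Submodule.smul_mem _ _ (filt_mono v ?_ ?_ (ih hw' .c₂)) <;>
          simp only [h, List.map_cons, List.sum_cons, deg_dual, lvl_dual,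
            show deg .c₂ = 0 from rfl, show lvl .c₂ = 0 from rfl] <;> omega
      · simp [pairing_eq_zero a b h]
    · refine toEnv_smul_mem (fun c hc => filt_mono v ?_ ?_ (ih hw' c))
        (brGen_sub_pairing_mem a b) <;> have h1 := hc.1 <;> have h2 := hc.2 <;>
        simp only [List.map_cons, List.sum_cons] <;> omega

theorem u_smul_mem (a : Gen) {d D : ℤ} {x : X} (hx : x ∈ filt v d D) :
    u a • x ∈ filt v (d + deg a) (D + lvl a) :=
  u_smul_mem_of_forall_word v (fun w h1 h2 h3 =>
    filt_mono v (by omega) (by omega) (u_smul_word_mem hv w h1 a)) hx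

theorem remainder_smul_mem (a b : Gen) {d D : ℤ} {x : X} (hx : x ∈ filt v d D) :
    toEnv Alg (brGen a b - pairing a b • e .c₂) • x
      ∈ filt v (d + deg a + deg b - 1) (D + lvl a + lvl b) := by
  refine toEnv_smul_mem (fun c hc => filt_mono v ?_ ?_ (u_smul_mem hv c hx))
    (brGen_sub_pairing_mem a b) <;> have h1 := hc.1 <;> have h2 := hc.2 <;> omega

omit hv

/-- The Euler operator of a finite set of annihilation operators. -/
noncomputable def euler (z₂ : ℂ) (S : Finset Gen) : Module.End ℂ X :=
  ∑ a ∈ S, (pairing a (dual a) * z₂)⁻¹ • Algebra.lsmul ℂ ℂ X (u (dual a) * u a)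

theorem euler_apply (S : Finset Gen) (x : X) :
    euler z₂ S x = ∑ a ∈ S, (pairing a (dual a) * z₂)⁻¹ • u (dual a) • u a • x := by
  simp [euler, mul_smul, LinearMap.sum_apply]

end Filtration

theorem finite_annihilators (N : ℕ) : {a : Gen | ¬ inStab (dual a) ∧ lvl (dual a) ≤ N}.Finite := by
  refine (((Set.finite_Icc 0 (N : ℤ)).image Gen.L).union
    (((Set.finite_Icc 0 (N : ℤ)).image Gen.M).union
      ((Set.finite_Icc 0 (N : ℤ)).image Gen.Q))).subset ?_
  rintro (n | n | n | _ | _) ⟨h1, h2⟩ <;> simp only [dual, inStab, lvl, not_true] at h1 h2 <;>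
    simp <;> omega

/-! ### The Euler operator and simplicity for c₂ ≠ 0 -/

section Euler

variable {X : Type*} [AddCommGroup X] [Module ℂ X] [Module U X] [IsScalarTower ℂ U X] {v : X}
  {z₁ z₂ : ℂ} (hv : ∀ a, inStab a → u a • v = charGen 0 0 z₁ z₂ a • v)
include hv

/-- Passing b through a and then through `dual a` gives the same sign twice, so the signs cancel. Of
the two brackets only [a, b] can have a leading term, since `dual a` pairs with a alone and a ≠ b.
-/
theorem comm_mem (a b : Gen) (hab : a ≠ b) {d D : ℤ} {x : X} (hx : x ∈ filt v d D) :
    u (dual a) • u a • u b • x - u b • u (dual a) • u a • x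
      - (pairing a b * z₂) • u (dual a) • x ∈ filt v (d + deg b - 1) (D + lvl b) := by
  have hs : sgn (dual a) b = sgn a b := by rw [sgn, sgn, parity_dual]
  have h1 := remainder_smul_mem hv (dual a) b (u_smul_mem hv a hx)
  have h2 := u_smul_mem hv (dual a) (remainder_smul_mem hv a b hx)
  rw [deg_dual, lvl_dual] at h1 h2
  have h3 := Submodule.add_mem _
    (filt_mono v (by omega) (by omega) (Submodule.smul_mem _ (sgn a b) h1))
    (filt_mono (d' := d + deg b - 1) (D' := D + lvl b) v (by omega) (by omega) h2)
  convert h3 using 1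
  rw [u_smul_u_smul a b, toEnv_brGen_smul, u_c_two_smul hv hx, smul_add, smul_add,
    smul_comm (u (dual a)) (sgn a b), u_smul_u_smul (dual a) b, toEnv_brGen_smul (dual a) b,
    pairing_eq_zero (dual a) b (by rw [dual_dual]; exact hab.symm), hs,
    smul_comm (u (dual a)) (pairing a b), smul_comm (u (dual a)) z₂, smul_add, smul_smul,
    sgn_mul_self]
  generalize u .c₂ • u a • x = y₁
  generalize toEnv Alg _ • u a • x = y₂
  generalize u (dual a) • toEnv Alg _ • x = y₃
  generalize u b • u (dual a) • u a • x = y₄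
  generalize u (dual a) • x = y₅
  module

/-- To leading order the commutator of `euler` with b has a single surviving summand, a = `dual b`,
and the normalising factor makes it exactly b. -/
theorem euler_u_smul (hz : z₂ ≠ 0) {S : Finset Gen} (hS : ∀ a ∈ S, inStab a) {b : Gen}
    (hb : ¬ inStab b) (hbS : dual b ∈ S) {d D : ℤ} {x : X} (hx : x ∈ filt v d D) :
    euler z₂ S (u b • x) - u b • euler z₂ S x - u b • x
      ∈ filt v (d + deg b - 1) (D + lvl b) := by
  have h := Submodule.sum_mem (t := S) (f := fun a => (pairing a (dual a) * z₂)⁻¹ •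
    (u (dual a) • u a • u b • x - u b • u (dual a) • u a • x
      - (pairing a b * z₂) • u (dual a) • x)) (filt v (d + deg b - 1) (D + lvl b))
    fun a ha => Submodule.smul_mem _ _ (comm_mem hv a b (fun h => hb (h ▸ hS a ha)) hx)
  have h1 : ∑ a ∈ S, (pairing a (dual a) * z₂)⁻¹ • (pairing a b * z₂) • u (dual a) • x
      = u b • x := by
    rw [Finset.sum_eq_single (dual b)]
    · rw [dual_dual, smul_smul, inv_mul_cancel₀ (mul_ne_zero (pairing_dual_ne_zero hb) hz),
        one_smul]
    · intro a _ ha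
      rw [pairing_eq_zero a b (fun h => ha (by rw [h, dual_dual]))]
      simp
    · exact fun h => (h hbS).elim
  convert h using 1
  simp only [smul_sub, Finset.sum_sub_distrib, h1, euler_apply, Finset.smul_sum]
  simp only [smul_comm (u b)]

theorem euler_word (hz : z₂ ≠ 0) {S : Finset Gen} (hS : ∀ a ∈ S, inStab a)
    (hS' : ∀ a ∈ S, u a • v = 0) (w : List Gen) (hw : ∀ b ∈ w, ¬ inStab b ∧ dual b ∈ S) :
    euler z₂ S (word v w) - (w.length : ℂ) • word v w
      ∈ filt v ((w.map deg).sum - 1) (w.map lvl).sum := by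
  induction w with
  | nil =>
    have : euler z₂ S v = 0 := by
      rw [euler_apply]
      exact Finset.sum_eq_zero fun a ha => by simp [hS' a ha]
    simp [word, this]
  | cons b w ih =>
    obtain ⟨hb, hw⟩ := List.forall_mem_cons.1 hw
    have h1 := euler_u_smul hv hz hS hb.1 hb.2 (word_mem_filt v fun a ha => (hw a ha).1)
    have h2 := u_smul_mem hv b (ih hw)
    have h3 := Submodule.add_mem _ h1 (filt_mono v (by omega) le_rfl h2)
    refine filt_mono v ?_ ?_ (?_ : _ ∈ filt v ((w.map deg).sum + deg b - 1)
      ((w.map lvl).sum + lvl b))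
    · simp only [List.map_cons, List.sum_cons]; omega
    · simp only [List.map_cons, List.sum_cons]; omega
    convert h3 using 1
    change euler z₂ S (u b • word v w) - ((w.length + 1 : ℕ) : ℂ) • u b • word v w = _
    rw [smul_sub, smul_comm (u b) (w.length : ℂ)]
    generalize euler z₂ S (u b • word v w) = y₁
    generalize u b • euler z₂ S (word v w) = y₂
    generalize u b • word v w = y₃
    push_cast
    module

omit hv [IsScalarTower ℂ U X]

/-- The refinement of the filtration by degree by word length, with the vacuum vector added. -/
noncomputable def fineFilt (v : X) (D d : ℤ) (j : ℕ) : Submodule ℂ X :=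
  Submodule.span ℂ {x | ∃ w : List Gen, (∀ a ∈ w, ¬ inStab a) ∧ (w.map lvl).sum ≤ D ∧
    (w = [] ∨ (w.map deg).sum < d ∨ (w.map deg).sum = d ∧ w.length ≤ j) ∧ x = word v w}

theorem three_mul_length_le {w : List Gen} (hw : ∀ a ∈ w, ¬ inStab a) :
    3 * (w.length : ℤ) ≤ (w.map lvl).sum := by
  induction w with
  | nil => simp
  | cons b w ih =>
    obtain ⟨hb, hw⟩ := List.forall_mem_cons.1 hw
    have := three_le_lvl hb
    have := ih hw
    simp only [List.map_cons, List.sum_cons, List.length_cons]; push_cast; omega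

theorem neg_length_le (w : List Gen) : -(w.length : ℤ) ≤ (w.map deg).sum := by
  induction w with
  | nil => simp
  | cons b w ih =>
    have := neg_one_le_deg b
    simp only [List.map_cons, List.sum_cons, List.length_cons]; push_cast; omega

theorem lvl_le_of_mem {w : List Gen} (hw : ∀ a ∈ w, ¬ inStab a) {b : Gen} (hb : b ∈ w) :
    lvl b ≤ (w.map lvl).sum := by
  induction w with
  | nil => simp at hb
  | cons c w ih =>
    obtain ⟨hc, hw⟩ := List.forall_mem_cons.1 hw
    have h1 := three_le_lvl hc
    have h2 := three_mul_length_le hw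
    simp only [List.map_cons, List.sum_cons]
    rcases List.mem_cons.1 hb with rfl | hb
    · omega
    · have := ih hw hb; omega

theorem filt_le_fineFilt {d' d D : ℤ} (j : ℕ) (h : d' < d) : filt v d' D ≤ fineFilt v D d j :=
  Submodule.span_mono fun _ ⟨w, h1, h2, h3, h4⟩ => ⟨w, h1, h3, .inr (.inl (by omega)), h4⟩

/-- For j = 0 no nonempty word of degree exactly d is left. Words of level at most N have length at
most N, so the bound j = N is no restriction in degree d - 1. -/
theorem fineFilt_zero_le (d : ℤ) (N : ℕ) : fineFilt v N d 0 ≤ fineFilt v N (d - 1) N := by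
  refine Submodule.span_mono fun _ ⟨w, h1, h2, h3, h4⟩ => ⟨w, h1, h2, ?_, h4⟩
  have := three_mul_length_le h1
  rcases h3 with h | h | ⟨_, h⟩
  · exact .inl h
  · by_cases h5 : (w.map deg).sum = d - 1
    · exact .inr (.inr ⟨h5, by omega⟩)
    · exact .inr (.inl (by omega))
  · exact .inl (List.length_eq_zero_iff.1 (by omega))

variable [IsScalarTower ℂ U X]
include hv

/-- `euler` - (j + 1) cancels the leading part of words of length j + 1 and preserves the lower
layer. On a vector killed by `euler` it is multiplication by the nonzero scalar -(j + 1). -/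
theorem mem_fineFilt_of_succ (hz : z₂ ≠ 0) {S : Finset Gen} (hS : ∀ a ∈ S, inStab a)
    (hS' : ∀ a ∈ S, u a • v = 0) {D d : ℤ} (hD : ∀ b, ¬ inStab b → lvl b ≤ D → dual b ∈ S) {j : ℕ}
    {x : X} (hx : x ∈ fineFilt v D d (j + 1)) (hE : euler z₂ S x = 0) :
    x ∈ fineFilt v D d j := by
  have key : euler z₂ S x - ((j + 1 : ℕ) : ℂ) • x ∈ fineFilt v D d j := by
    clear hE
    induction hx using Submodule.span_induction with
    | mem x hx =>
      obtain ⟨w, h1, h2, h3, rfl⟩ := hx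
      have hw := euler_word hv hz hS hS' w fun b hb => ⟨h1 b hb, hD b (h1 b hb)
        ((lvl_le_of_mem h1 hb).trans h2)⟩
      have h4 : euler z₂ S (word v w) - (w.length : ℂ) • word v w ∈ fineFilt v D d j := by
        rcases h3 with rfl | h3 | h3
        · have : euler z₂ S v = 0 := by
            rw [euler_apply]
            exact Finset.sum_eq_zero fun a ha => by simp [hS' a ha]
          simp [word, this]
        · exact filt_le_fineFilt j (by omega) (filt_mono v le_rfl h2 hw)
        · exact filt_le_fineFilt j (by omega) (filt_mono v le_rfl h2 hw)
      have h5 : ((w.length : ℂ) - ((j + 1 : ℕ) : ℂ)) • word v w ∈ fineFilt v D d j := by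
        by_cases h6 : w.length = j + 1
        · simp [h6]
        · refine Submodule.smul_mem _ _ (Submodule.subset_span ⟨w, h1, h2, ?_, rfl⟩)
          rcases h3 with h3 | h3 | h3
          · exact .inl h3
          · exact .inr (.inl h3)
          · exact .inr (.inr ⟨h3.1, by omega⟩)
      convert Submodule.add_mem _ h4 h5 using 1
      module
    | zero => simp
    | add x y _ _ hx hy =>
      convert Submodule.add_mem _ hx hy using 1
      rw [map_add]; module
    | smul r x _ hx =>
      convert Submodule.smul_mem _ r hx using 1
      rw [map_smul]; module
  rw [hE, zero_sub, neg_mem_iff] at key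
  exact (Submodule.smul_mem_iff _ (by exact_mod_cast j.succ_ne_zero)).1 key

theorem mem_span_of_euler_eq_zero (hz : z₂ ≠ 0) {S : Finset Gen} (hS : ∀ a ∈ S, inStab a)
    (hS' : ∀ a ∈ S, u a • v = 0) {N : ℕ} (hD : ∀ b, ¬ inStab b → lvl b ≤ N → dual b ∈ S) {d : ℤ}
    {x : X} (hx : x ∈ filt v d N) (hE : euler z₂ S x = 0) : x ∈ Submodule.span ℂ {v} := by
  have h1 (d : ℤ) (j : ℕ) (h : x ∈ fineFilt v N d j) : x ∈ fineFilt v N d 0 := by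
    induction j with
    | zero => exact h
    | succ j ih => exact ih (mem_fineFilt_of_succ hv hz hS hS' hD h hE)
  have h2 (k : ℕ) : x ∈ fineFilt v N (d + 1 - k) 0 := by
    induction k with
    | zero => exact filt_le_fineFilt 0 (by simp) hx
    | succ k ih =>
      have := h1 _ _ (fineFilt_zero_le _ _ ih)
      rwa [show d + 1 - ((k + 1 : ℕ) : ℤ) = d + 1 - k - 1 by push_cast; ring]
  -- This many steps bring the degree bound to at most -N, while a word of level at most N has
  -- degree at least minus its length, so at least -N. Only the empty word remains.
  refine Submodule.span_mono ?_ (h2 (d + 1 + N).toNat)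
  rintro _ ⟨w, h3, h4, h5, rfl⟩
  have h6 := three_mul_length_le h3
  have h7 := neg_length_le w
  have h8 : w = [] := by
    rcases h5 with h | h | h
    · exact h
    · omega
    · exact List.length_eq_zero_iff.1 (by omega)
  rw [h8]; rfl

theorem exists_mem_filt (hg : ∀ x : X, ∃ w : U, w • v = x) (x : X) :
    ∃ d D : ℤ, x ∈ filt v d D := by
  have hadd {x y : X} (hx : ∃ d D : ℤ, x ∈ filt v d D) (hy : ∃ d D : ℤ, y ∈ filt v d D) :
      ∃ d D : ℤ, x + y ∈ filt v d D := by
    obtain ⟨d, D, hx⟩ := hx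
    obtain ⟨d', D', hy⟩ := hy
    exact ⟨max d d', max D D', Submodule.add_mem _
      (filt_mono v (le_max_left _ _) (le_max_left _ _) hx)
      (filt_mono v (le_max_right _ _) (le_max_right _ _) hy)⟩
  obtain ⟨w, rfl⟩ := hg x
  suffices h : ∀ x : X, (∃ d D : ℤ, x ∈ filt v d D) → ∃ d D : ℤ, w • x ∈ filt v d D from
    h v ⟨0, 0, word_mem_filt v (w := []) (by simp)⟩
  have hw : w ∈ Algebra.adjoin ℂ (Set.range u) := u_generates ▸ Algebra.mem_top
  induction hw using Algebra.adjoin_induction with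
  | mem w hw =>
    obtain ⟨a, rfl⟩ := hw
    rintro x ⟨d, D, hx⟩
    exact ⟨_, _, u_smul_mem hv a hx⟩
  | algebraMap r =>
    rintro x ⟨d, D, hx⟩
    exact ⟨d, D, by rw [algebraMap_smul]; exact Submodule.smul_mem _ r hx⟩
  | add w w' _ _ h1 h2 => intro x hx; rw [add_smul]; exact hadd (h1 x hx) (h2 x hx)
  | mul w w' _ _ h1 h2 => intro x hx; rw [mul_smul]; exact h1 _ (h2 x hx)

/-- A nonzero vector of K of least level is killed by every annihilator, as its image would be a
vector of K of smaller level. -/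
theorem mem_of_ne_bot (hz : z₂ ≠ 0) (hg : ∀ x : X, ∃ w : U, w • v = x) (K : Submodule U X)
    (hK : K ≠ ⊥) : v ∈ K := by
  classical
  have hex : ∃ N : ℕ, ∃ x ∈ K, x ≠ 0 ∧ ∃ d : ℤ, x ∈ filt v d N := by
    obtain ⟨x, hx, hx0⟩ := K.exists_mem_ne_zero_of_ne_bot hK
    obtain ⟨d, D, h⟩ := exists_mem_filt hv hg x
    exact ⟨D.toNat, x, hx, hx0, d, filt_mono v le_rfl (by omega) h⟩
  obtain ⟨x, hx, hx0, d, hd⟩ := Nat.find_spec hex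
  have hmin := fun m => Nat.find_min hex (m := m)
  generalize Nat.find hex = N at hd hmin
  -- The duals of all letters that can occur at level at most N: finitely many, so the Euler
  -- operator is a finite sum.
  set S := (finite_annihilators N).toFinset
  have hS (a : Gen) (ha : a ∈ S) : ¬ inStab (dual a) ∧ lvl (dual a) ≤ N := by
    simpa [S] using ha
  have hS1 (a : Gen) (ha : a ∈ S) : inStab a ∧ charGen 0 0 z₁ z₂ a = 0 := by
    have h := (hS a ha).1
    rcases a with n | n | n | _ | _ <;> simp only [dual, inStab, charGen, not_true] at h ⊢ <;>
      simp <;> omega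
  have hE : euler z₂ S x = 0 := by
    rw [euler_apply]
    refine Finset.sum_eq_zero fun a ha => ?_
    have h1 := three_le_lvl (hS a ha).1
    have h2 := (hS a ha).2
    rw [lvl_dual] at h1 h2
    -- Here -N ≤ `lvl a` ≤ -3, so `toNat` truncates nothing and the new level is smaller than N.
    have h3 := hmin (N + lvl a).toNat (by omega)
    push Not at h3
    have h4 : u a • x = 0 := by
      by_contra h
      exact h3 _ (K.smul_mem (u a) hx) h _ (filt_mono v le_rfl (by omega) (u_smul_mem hv a hd))
    rw [h4, smul_zero, smul_zero]
  have hspan := mem_span_of_euler_eq_zero hv hz (fun a ha => (hS1 a ha).1)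
    (fun a ha => by rw [hv a (hS1 a ha).1, (hS1 a ha).2, zero_smul])
    (fun b hb hN => by simpa [S, dual_dual] using ⟨hb, hN⟩) hd hE
  obtain ⟨r, rfl⟩ := Submodule.mem_span_singleton.1 hspan
  have hr : r ≠ 0 := fun h => hx0 (by rw [h, zero_smul])
  have := K.smul_mem (algebraMap ℂ U r⁻¹) hx
  rwa [algebraMap_smul, smul_smul, inv_mul_cancel₀ hr, one_smul] at this

end Euler

theorem isSimpleModule_vacuum (z₁ z₂ : ℂ) (hz : z₂ ≠ 0) : IsSimpleModule U (Vacuum z₁ z₂) := by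
  have : Nontrivial (Vacuum z₁ z₂) := ⟨_, _, vac_ne_zero z₁ z₂⟩
  refine isSimpleModule_iff_toSpanSingleton_surjective.2 ⟨this, fun x hx y => ?_⟩
  have hK : vac z₁ z₂ ∈ Submodule.span U {x} := mem_of_ne_bot (u_smul_vac z₁ z₂) hz
    (exists_smul_vac z₁ z₂) (Submodule.span U {x})
    (by simpa using hx)
  obtain ⟨r, hr⟩ := Submodule.mem_span_singleton.1 hK
  obtain ⟨w, rfl⟩ := exists_smul_vac z₁ z₂ y
  exact ⟨w * r, by rw [LinearMap.toSpanSingleton_apply, mul_smul, hr]⟩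

/-! ### A proper nonzero submodule for c₂ = 0 -/

/-- The endomorphism of `U` that kills `M_n`, `Q_r` and `c₂` and fixes the Virasoro subalgebra. -/
noncomputable def toVir : U →ₐ[ℂ] U :=
  lift (fun a => match a with
    | .L n => u (.L n)
    | .c₁ => u .c₁
    | _ => 0) fun a b => by
    have h (a b : Gen) : u a * u b - sgn a b • (u b * u a)
        = Finsupp.linearCombination ℂ u (brGen a b) := by
      rw [u_mul_u, toEnv_eq, add_sub_cancel_left]
    have he (f : Gen → U) (a : Gen) : Finsupp.linearCombination ℂ f (e a) = f a := by simp [e]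
    -- The relations survive because the M_n, Q_r and c₂ span an ideal complementary to the Virasoro
    -- subalgebra.
    rcases a with m | m | m | _ | _ <;> rcases b with n | n | n | _ | _ <;>
      simp only [mul_zero, zero_mul, smul_zero, sub_zero, h] <;> simp only [brGen] <;> (try split_ifs) <;> simp [he]

/-- The vanishing of the second central charge enters here: `toVir` sends c₂ to 0, which must agree
with the scalar by which c₂ acts. -/
theorem toVir_u_smul {X : Type*} [AddCommGroup X] [Module ℂ X] [Module U X] {v : X} {z₁ : ℂ}
    (hv : ∀ a, inStab a → u a • v = charGen 0 0 z₁ 0 a • v) (a : Gen) (ha : inStab a) :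
    toVir (u a) • v = charGen 0 0 z₁ 0 a • v := by
  rw [toVir, lift_u]
  rcases a with n | n | n | _ | _
  · exact hv _ ha
  · simp [charGen]
  · simp [charGen]
  · exact hv _ ha
  · simp [charGen]

theorem toVir_smul_vac_eq_zero (z₁ : ℂ) (w : U) (hw : w • vac z₁ 0 = 0) :
    toVir w • vac z₁ 0 = 0 :=
  apply_eq_zero_of_smul_vac_eq_zero z₁ 0 ((Algebra.lsmul ℂ ℂ (Vacuum z₁ 0)).comp toVir) _
    (toVir_u_smul (u_smul_vac z₁ 0)) w hw

/-- Simplicity would give r with r Q_{-3/2} 𝟏 = 𝟏. Applying `toVir` to 1 - r Q_{-3/2}, which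
annihilates 𝟏, yields 𝟏 = 0. -/
theorem not_isSimpleModule_vacuum (z₁ : ℂ) : ¬ IsSimpleModule U (Vacuum z₁ 0) := by
  intro h
  obtain ⟨r, hr⟩ := (isSimpleModule_iff_toSpanSingleton_surjective.1 h).2 _
    (u_Q_smul_vac_ne_zero z₁ 0) (vac z₁ 0)
  rw [LinearMap.toSpanSingleton_apply, smul_smul] at hr
  have h1 := toVir_smul_vac_eq_zero z₁ (1 - r * u (.Q (-2))) (by rw [sub_smul, hr, one_smul,
    sub_self])
  have h2 : toVir (u (.Q (-2))) = 0 := by rw [toVir, lift_u]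
  rw [map_sub, map_mul, h2, map_one, mul_zero, sub_zero, one_smul] at h1
  exact vac_ne_zero z₁ 0 h1

end BMS

theorem theorem3p3 (c₁ c₂ : ℂ) :
    IsSimpleModule BMS.U (BMS.Vacuum c₁ c₂) ↔ c₂ ≠ 0 := by
  refine ⟨?_, BMS.isSimpleModule_vacuum c₁ c₂⟩
  rintro h rfl
  exact BMS.not_isSimpleModule_vacuum c₁ h
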